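/- Let $F$ be a totally real number field of degree $m$ with ring of integers $\mathcal{O}_F$, let $\mathfrak{n}$ be a nonzero ideal of $\mathcal{O}_F$, and let $k=(k_1,\dots,k_m)$ be a weight with all $k_j$ even and $k_j\ge 2$; put $k_0=\max_j k_j$. Let $\mathfrak{S}_k(\mathfrak{n})=\prod_{\nu} S_k(\Gamma_\nu(\mathfrak{n}))$ be the space of Hilbert cusp forms of weight $k$ and level $\mathfrak{n}$, where $\nu$ runs over the narrow ideal classes of $F$, $\mathfrak{t}_\nu$ is a fractional ideal representing $\nu$, and, with $\mathfrak{D}_F$ the different of $F$, $\Gamma_\nu(\mathfrak{n})$ is the group of matrices $\begin{pmatrix}a&b\\c&d\end{pmatrix}$ with $a,d\in\mathcal{O}_F$, $b\in(\mathfrak{t}_\nu\mathfrak{D}_F)^{-1}$, $c\in\mathfrak{n}\mathfrak{t}_\nu\mathfrak{D}_F$ and totally positive determinant $ad-bc\in\mathcal{O}_F^\times$. For $\mathbf{f}=(f_\nu)_\nu\in\mathfrak{S}_k(\mathfrak{n})$ with $f_\nu(\tau)=\sum_{0\ll\xi\in\mathfrak{t}_\nu}a_\nu(\xi)\,e^{2\pi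 i\sum_j\xi_j\tau_j}$ and a nonzero integral ideal $\mathfrak{m}=\xi\mathfrak{t}_\nu^{-1}$, $\xi\gg0$, put $$C_{\mathbf f}(\mathfrak{m})=a_\nu(\xi)\prod_j\xi_j^{-k_j/2}\,\mathrm{N}(\mathfrak{m})^{k_0/2},\qquad c_{\mathbf f}(\mathfrak{m})=\frac{C_{\mathbf f}(\mathfrak{m})}{\mathrm{N}(\mathfrak{m})^{(k_0-1)/2}} .$$ Let $\mathbf f$ be a primitive form of weight $k$ and level $\mathfrak{n}$ with trivial character; that is, $\mathbf f\in\mathfrak{S}_k(\mathfrak{n})$ is orthogonal, for the Petersson product, to all forms coming from levels properly dividing $\mathfrak{n}$, is an eigenfunction of all Hecke operators $T_{\mathfrak{m}}$, is normalized by $C_{\mathbf f}(\mathcal{O}_F)=1$, and, as a function on $\mathrm{GL}_2(\mathbb{A}_F)$, is invariant under the centre $\mathbb{A}_F^\times$. Let $\mathfrak{p}\nmid\mathfrak{n}$ be a nonzero prime ideal and let $\theta_{\mathfrak p}\in[0,\pi]$ be its Hecke eigenangle, defined by $c_{\mathbf f}(\mathfrak{p})=2\cos\theta_{\mathfrak p}$.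 Write $\|x\|$ for the distance from $x$ to the nearest integer, and suppose that $\theta_{\mathfrak p}/\pi$ is badly approximable, i.e. that there is $\eta>0$ with $$\Bigl\|q\,\frac{\theta_{\mathfrak p}}{\pi}\Bigr\|>\frac{\eta}{q}\qquad\text{for all integers } q\ge1. \tag{1}$$ Then there is a constant $\eta_{\mathbf f}>0$, independent of $n$, such that $$|c_{\mathbf f}(\mathfrak{p}^n)|>\frac{\eta_{\mathbf f}}{n+1}\qquad\text{for every integer } n\ge1 .$$ More precisely, every $\eta>0$ that satisfies (1) can be taken as $\eta_{\mathbf f}$. -/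

import Mathlib

open NumberField UpperHalfPlane MeasureTheory
open scoped nonZeroDivisors MatrixGroups ComplexConjugate

noncomputable section

namespace HilbertForm

section totallyPositive

variable {F : Type*} [Field F]

/-- `x ≫ 0`. -/
def TotPos (x : F) : Prop := ∀ σ : F →+* ℝ, 0 < σ x

lemma TotPos.mul {x y : F} (hx : TotPos x) (hy : TotPos y) : TotPos (x * y) := fun σ => by
  rw [map_mul]; exact mul_pos (hx σ) (hy σ)

lemma TotPos.inv {x : F} (hx : TotPos x) : TotPos x⁻¹ := fun σ => by
  rw [map_inv₀]; exact inv_pos.mpr (hx σ)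

end totallyPositive

variable (F : Type*) [Field F] [NumberField F]

/-- The `m`-fold product of upper half planes, one factor for each real embedding of `F`
(there are `m = [F : ℚ]` of them when `F` is totally real). -/
abbrev HalfSpace : Type _ := (F →+* ℝ) → ℍ

/-- The group of totally positive elements of `Fˣ`. -/
def totPosUnits : Subgroup Fˣ where
  carrier := {x | TotPos (x : F)}
  mul_mem' {x y} hx hy := by
    have h := TotPos.mul (x := (x : F)) (y := (y : F)) hx hy
    simpa using h
  one_mem' σ := by simp
  inv_mem' {x} hx := by
    have h := TotPos.inv (x := (x : F)) hx
    simpa using h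

/-- The narrow class group: fractional ideals modulo principal ideals with a totally positive
generator. -/
abbrev NarrowClassGroup : Type _ :=
  (FractionalIdeal (𝓞 F)⁰ F)ˣ ⧸ (totPosUnits F).map (toPrincipalIdeal (𝓞 F) F)

/-- The different of `F`, as a fractional ideal. -/
def different : FractionalIdeal (𝓞 F)⁰ F := (differentIdeal ℤ (𝓞 F) : Ideal (𝓞 F))

variable {F}

lemma different_ne_zero : different F ≠ 0 :=
  FractionalIdeal.coeIdeal_ne_zero.mpr (by
    simpa using (differentIdeal_ne_bot (A := ℤ) (B := 𝓞 F)))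

/-- The congruence subgroup `Γ(𝔱, 𝔫)` of `GL₂⁺(F)`: matrices with diagonal entries in `𝓞`, upper
right entry in `(𝔱𝔇)⁻¹`, lower left entry in `𝔫𝔇𝔱` and totally positive determinant in `𝓞ˣ`. -/
def Gamma (𝔱 : (FractionalIdeal (𝓞 F)⁰ F)ˣ) (𝔫 : Ideal (𝓞 F)) : Subgroup (GL (Fin 2) F) where
  carrier := {γ | TotPos γ.1.det ∧ FractionalIdeal.spanSingleton (𝓞 F)⁰ γ.1.det = 1 ∧
    γ.1 0 0 ∈ (1 : FractionalIdeal (𝓞 F)⁰ F) ∧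
    γ.1 0 1 ∈ ((𝔱 : FractionalIdeal (𝓞 F)⁰ F) * different F)⁻¹ ∧
    γ.1 1 0 ∈ (𝔫 : FractionalIdeal (𝓞 F)⁰ F) * (𝔱 * different F) ∧
    γ.1 1 1 ∈ (1 : FractionalIdeal (𝓞 F)⁰ F)}
  mul_mem' {x y} := by
    rintro ⟨h1, h2, h3, h4, h5, h6⟩ ⟨k1, k2, k3, k4, k5, k6⟩
    have hI : (𝔱 : FractionalIdeal (𝓞 F)⁰ F) * different F ≠ 0 :=
      mul_ne_zero 𝔱.ne_zero different_ne_zero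
    generalize (𝔱 : FractionalIdeal (𝓞 F)⁰ F) * different F = I at *
    have hle : (𝔫 : FractionalIdeal (𝓞 F)⁰ F) ≤ 1 := FractionalIdeal.coeIdeal_le_one
    have e1 : I⁻¹ * ((𝔫 : FractionalIdeal (𝓞 F)⁰ F) * I) = 𝔫 := by field_simp
    have e2 : ((𝔫 : FractionalIdeal (𝓞 F)⁰ F) * I) * I⁻¹ = 𝔫 := by field_simp
    simp only [Set.mem_ofPred_eq, Units.val_mul, Matrix.det_mul, Matrix.mul_apply,
      Fin.sum_univ_two]
    refine ⟨h1.mul k1, ?_, ?_, ?_, ?_, ?_⟩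
    · rw [← FractionalIdeal.spanSingleton_mul_spanSingleton, h2, k2, one_mul]
    · exact (1 : FractionalIdeal (𝓞 F)⁰ F).1.add_mem
        (by simpa using FractionalIdeal.mul_mem_mul h3 k3)
        (hle (e1 ▸ FractionalIdeal.mul_mem_mul h4 k5))
    · exact (I⁻¹).1.add_mem
        (by simpa using FractionalIdeal.mul_mem_mul h3 k4)
        (by simpa using FractionalIdeal.mul_mem_mul h4 k6)
    · exact ((𝔫 : FractionalIdeal (𝓞 F)⁰ F) * I).1.add_mem
        (mul_one ((𝔫 : FractionalIdeal (𝓞 F)⁰ F) * I) ▸ FractionalIdeal.mul_mem_mul h5 k3)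
        (one_mul ((𝔫 : FractionalIdeal (𝓞 F)⁰ F) * I) ▸ FractionalIdeal.mul_mem_mul h6 k5)
    · exact (1 : FractionalIdeal (𝓞 F)⁰ F).1.add_mem
        (hle (e2 ▸ FractionalIdeal.mul_mem_mul h5 k4))
        (by simpa using FractionalIdeal.mul_mem_mul h6 k6)
  one_mem' := by
    refine ⟨fun σ => by simp, by simp, ?_, ?_, ?_, ?_⟩
    · simp
    · simpa using FractionalIdeal.zero_mem _
    · simpa using FractionalIdeal.zero_mem _
    · simp
  inv_mem' {x} := by
    rintro ⟨h1, h2, h3, h4, h5, h6⟩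
    have hd : (x.1.det)⁻¹ ∈ (1 : FractionalIdeal (𝓞 F)⁰ F) := by
      have h := FractionalIdeal.mem_spanSingleton_self (𝓞 F)⁰ (x.1.det)⁻¹
      rwa [← FractionalIdeal.spanSingleton_inv, h2, inv_one] at h
    have key : ∀ (J : FractionalIdeal (𝓞 F)⁰ F) (y : F), y ∈ J → (x.1.det)⁻¹ * y ∈ J :=
      fun J y hy => by simpa using FractionalIdeal.mul_mem_mul hd hy
    have neg : ∀ (J : FractionalIdeal (𝓞 F)⁰ F) (y : F), y ∈ J → -y ∈ J :=
      fun J y hy => J.1.neg_mem hy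
    have hx : (x⁻¹).1 = (x.1.det)⁻¹ • x.1.adjugate := by
      rw [Matrix.coe_units_inv, Matrix.inv_def, Ring.inverse_eq_inv']
    have hdet : (x⁻¹).1.det = (x.1.det)⁻¹ := by
      rw [Matrix.coe_units_inv, Matrix.det_nonsing_inv, Ring.inverse_eq_inv']
    refine ⟨?_, ?_, ?_, ?_, ?_, ?_⟩
    · rw [hdet]; exact h1.inv
    · rw [hdet, ← FractionalIdeal.spanSingleton_inv, h2, inv_one]
    · rw [hx, Matrix.adjugate_fin_two]; simpa using key _ _ h6
    · rw [hx, Matrix.adjugate_fin_two]; simpa using neg _ _ (key _ _ h4)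
    · rw [hx, Matrix.adjugate_fin_two]; simpa using neg _ _ (key _ _ h5)
    · rw [hx, Matrix.adjugate_fin_two]; simpa using key _ _ h3

/-- The action of `GL₂⁺(F)` on the product of upper half planes by fractional linear
transformations in every coordinate. -/
def moebius (β : GL (Fin 2) F) (τ : HalfSpace F) : HalfSpace F :=
  fun σ => Matrix.GeneralLinearGroup.map σ β • τ σ

/-- The slash operator `(f ‖ₖ β)(τ) = (det β)^{k/2} (cτ + d)^{-k} f(β τ)`, used for `β` with
totally positive determinant. -/
def slash (k : (F →+* ℝ) → ℕ) (f : HalfSpace F → ℂ) (β : GL (Fin 2) F) : HalfSpace F → ℂ :=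
  fun τ => (∏ σ : F →+* ℝ, (((σ β.1.det) ^ ((k σ : ℝ) / 2) : ℝ) : ℂ)) *
    (∏ σ : F →+* ℝ, ((σ (β.1 1 0) : ℂ) * (τ σ : ℂ) + (σ (β.1 1 1) : ℂ)) ^ k σ)⁻¹ *
    f (moebius β τ)

/-- Holomorphy of a function on the product of upper half planes. -/
def IsHolomorphic (f : HalfSpace F → ℂ) : Prop :=
  DifferentiableOn ℂ (fun z : (F →+* ℝ) → ℂ => f (fun σ => UpperHalfPlane.ofComplex (z σ)))
    {z | ∀ σ, 0 < (z σ).im}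

/-- `exp(2πi ∑ⱼ ξⱼ τⱼ)`. -/
def expTrace (ξ : F) (τ : HalfSpace F) : ℂ :=
  Complex.exp (2 * Real.pi * Complex.I * ∑ σ : F →+* ℝ, (σ ξ : ℂ) * (τ σ : ℂ))

/-- `f(τ) = ∑ a(ξ) exp(2πi ∑ⱼ ξⱼ τⱼ)`, an absolutely convergent sum over the elements `ξ` of some
fractional ideal (`a` is extended by zero to `F`). -/
def HasFourierExpansion (f : HalfSpace F → ℂ) (a : F → ℂ) : Prop :=
  (∃ L : FractionalIdeal (𝓞 F)⁰ F, ∀ ξ, a ξ ≠ 0 → ξ ∈ L) ∧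
    ∀ τ, HasSum (fun ξ : F => a ξ * expTrace ξ τ) (f τ)

open Classical in
/-- The Fourier coefficient of `f` at `ξ` (with value `0` if `f` has no Fourier expansion). -/
def fourierCoeff (f : HalfSpace F → ℂ) (ξ : F) : ℂ :=
  if h : ∃ a, HasFourierExpansion f a then h.choose ξ else 0

/-- `f ∈ M_k(Γ)`: holomorphic, invariant under `Γ`, and holomorphic at the cusps. -/
structure IsModularForm (k : (F →+* ℝ) → ℕ) (Γ : Subgroup (GL (Fin 2) F))
    (f : HalfSpace F → ℂ) : Prop where
  holo : IsHolomorphic f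
  slash_eq : ∀ γ ∈ Γ, slash k f γ = f
  holo_cusps : ∀ α : GL (Fin 2) F, TotPos α.1.det →
    ∃ a, HasFourierExpansion (slash k f α) a ∧ ∀ ξ, a ξ ≠ 0 → ξ = 0 ∨ TotPos ξ

/-- `f ∈ S_k(Γ)`: the constant term of `f ‖ₖ α` vanishes for all `α ∈ GL₂⁺(F)`. -/
structure IsCuspForm (k : (F →+* ℝ) → ℕ) (Γ : Subgroup (GL (Fin 2) F))
    (f : HalfSpace F → ℂ) : Prop extends IsModularForm k Γ f where
  zero_at_cusps : ∀ α : GL (Fin 2) F, TotPos α.1.det → fourierCoeff (slash k f α) 0 = 0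

/-- A collection `(f_ν)` of functions indexed by the narrow ideal classes. -/
abbrev Family (F : Type*) [Field F] [NumberField F] : Type _ :=
  NarrowClassGroup F → HalfSpace F → ℂ

/-- `t` selects a fractional ideal `t ν` in each narrow ideal class `ν`. -/
def IsRepresentatives (t : NarrowClassGroup F → (FractionalIdeal (𝓞 F)⁰ F)ˣ) : Prop :=
  ∀ ν, QuotientGroup.mk (t ν) = ν

section adelic

variable (t : NarrowClassGroup F → (FractionalIdeal (𝓞 F)⁰ F)ˣ) (k : (F →+* ℝ) → ℕ)
  (𝔫 : Ideal (𝓞 F))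

/-- `𝐟 ∈ 𝔖_k(𝔫) = ∏_ν S_k(Γ_ν(𝔫))`. -/
def IsHilbertCuspForm (f : Family F) : Prop := ∀ ν, IsCuspForm k (Gamma (t ν) 𝔫) (f ν)

/-- The part of `GL₂⁺(F)` over which the centre of `GL₂(𝔸_F)` acts. If `z` is a finite idele with
ideal `𝔷` and `x_ν = diag(t_ν⁻¹, 1)`, this is the set of the `γ^ι` (main involution) for
`γ ∈ GL₂⁺(F)` with `γ x_μ ∈ x_ν z K₀(𝔫)`. -/
def centralSet (𝔷 : (FractionalIdeal (𝓞 F)⁰ F)ˣ) (ν μ : NarrowClassGroup F) :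
    Set (GL (Fin 2) F) :=
  {β | TotPos β.1.det ∧
    FractionalIdeal.spanSingleton (𝓞 F)⁰ β.1.det = 
      (𝔷 * 𝔷 * t μ * (t ν)⁻¹ : (FractionalIdeal (𝓞 F)⁰ F)ˣ) ∧
    β.1 0 0 ∈ (𝔷 : FractionalIdeal (𝓞 F)⁰ F) ∧
    β.1 0 1 ∈ (𝔷 : FractionalIdeal (𝓞 F)⁰ F) * ((t ν : FractionalIdeal (𝓞 F)⁰ F) * different F)⁻¹ ∧
    β.1 1 0 ∈ (𝔷 : FractionalIdeal (𝓞 F)⁰ F) * ((𝔫 : FractionalIdeal (𝓞 F)⁰ F) *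
      (t μ * different F)) ∧
    β.1 1 1 ∈ ((𝔷 * t μ * (t ν)⁻¹ : (FractionalIdeal (𝓞 F)⁰ F)ˣ) : FractionalIdeal (𝓞 F)⁰ F)}

/-- `𝐟` has trivial character: as a function on `GL₂(𝔸_F)` it is invariant under the centre
`𝔸_Fˣ`. -/
def HasTrivialCharacter (f : Family F) : Prop :=
  ∀ (𝔷 : (FractionalIdeal (𝓞 F)⁰ F)ˣ) (ν μ : NarrowClassGroup F),
    ∀ β ∈ centralSet t 𝔫 𝔷 ν μ, slash k (f μ) β = f ν

/-- The matrices over which the `ν`-th component of `T_𝔪 𝐟` is summed: entries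
`a ∈ 𝓞` prime to `𝔫`, `b ∈ (t_ν𝔇)⁻¹`, `c ∈ 𝔫𝔇t_μ`, `d ∈ t_μt_ν⁻¹` and totally positive determinant
generating `𝔪t_μt_ν⁻¹`. It is nonempty only for the one `μ` such that `𝔪t_μt_ν⁻¹` is trivial in the
narrow class group. -/
def heckeSet (𝔪 : Ideal (𝓞 F)) (ν μ : NarrowClassGroup F) : Set (GL (Fin 2) F) :=
  {β | TotPos β.1.det ∧
    FractionalIdeal.spanSingleton (𝓞 F)⁰ β.1.det =
      (𝔪 : FractionalIdeal (𝓞 F)⁰ F) * (t μ * (t ν)⁻¹ : (FractionalIdeal (𝓞 F)⁰ F)ˣ) ∧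
    (∃ a : 𝓞 F, β.1 0 0 = (a : F) ∧ Ideal.span {a} ⊔ 𝔫 = ⊤) ∧
    β.1 0 1 ∈ ((t ν : FractionalIdeal (𝓞 F)⁰ F) * different F)⁻¹ ∧
    β.1 1 0 ∈ (𝔫 : FractionalIdeal (𝓞 F)⁰ F) * (t μ * different F) ∧
    β.1 1 1 ∈ ((t μ * (t ν)⁻¹ : (FractionalIdeal (𝓞 F)⁰ F)ˣ) : FractionalIdeal (𝓞 F)⁰ F)}

/-- `k₀ = max_j k_j`. -/
def maxWeight (k : (F →+* ℝ) → ℕ) : ℕ := Finset.univ.sup k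

/-- The Hecke operator `T_𝔪` of level `𝔫`:
`(T_𝔪 𝐟)_ν = N(𝔪)^{k₀/2 - 1} ∑_β f_μ ‖ₖ β`, with `β` running over the cosets
`Γ_μ(𝔫) \ heckeSet`. All sums are finite. -/
def hecke (𝔪 : Ideal (𝓞 F)) (f : Family F) : Family F := fun ν τ =>
  (((Ideal.absNorm 𝔪 : ℝ) ^ ((maxWeight k : ℝ) / 2 - 1) : ℝ) : ℂ) *
    ∑ᶠ μ : NarrowClassGroup F,
      ∑ᶠ q ∈ (Quotient.mk (QuotientGroup.rightRel (Gamma (t μ) 𝔫))) '' heckeSet t 𝔫 𝔪 ν μ,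
        slash k (f μ) (Quotient.out q) τ

open Classical in
/-- `C_𝐟(𝔪) = a_ν(ξ) ξ^{-k/2} N(𝔪)^{k₀/2}`, where `𝔪 = ξ t_ν⁻¹` with `ξ ≫ 0`. -/
def coeffC (f : Family F) (𝔪 : Ideal (𝓞 F)) : ℂ :=
  if h : ∃ x : NarrowClassGroup F × F, TotPos x.2 ∧
      (𝔪 : FractionalIdeal (𝓞 F)⁰ F) =
        FractionalIdeal.spanSingleton (𝓞 F)⁰ x.2 * ((t x.1)⁻¹ : (FractionalIdeal (𝓞 F)⁰ F)ˣ)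
  then
    fourierCoeff (f h.choose.1) h.choose.2 *
      (∏ σ : F →+* ℝ, (((σ h.choose.2) ^ (-(k σ : ℝ) / 2) : ℝ) : ℂ)) *
      (((Ideal.absNorm 𝔪 : ℝ) ^ ((maxWeight k : ℝ) / 2) : ℝ) : ℂ)
  else 0

/-- The normalized coefficient `c_𝐟(𝔪) = C_𝐟(𝔪) / N(𝔪)^{(k₀-1)/2}`. -/
def normCoeff (f : Family F) (𝔪 : Ideal (𝓞 F)) : ℂ :=
  coeffC t k f 𝔪 / (((Ideal.absNorm 𝔪 : ℝ) ^ (((maxWeight k : ℝ) - 1) / 2) : ℝ) : ℂ)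

/-- `D` is a (strict, Borel) fundamental domain for the action of `Γ`. -/
def IsFundDomain (Γ : Subgroup (GL (Fin 2) F)) (D : Set (HalfSpace F)) : Prop :=
  MeasurableSet D ∧ ∀ τ, ∃! τ', τ' ∈ D ∧ ∃ γ ∈ Γ, τ' = moebius γ τ

/-- The Petersson product `∑_ν ∫_{Γ_ν \ ℍ^m} f_ν(τ) conj(g_ν(τ)) y^k dμ(τ)`, computed with
fundamental domains `D ν` for `Γ_ν`; `dμ` is the product of the hyperbolic measures `dx dy / y²`. -/
def petersson (D : NarrowClassGroup F → Set (HalfSpace F)) (f g : Family F) : ℂ :=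
  ∑ᶠ ν : NarrowClassGroup F,
    ∫ τ in D ν, f ν τ * conj (g ν τ) * ∏ σ : F →+* ℝ, (((τ σ).im ^ k σ : ℝ) : ℂ)

/-- `𝐡` is obtained from `𝐠` by the level raising operator of `𝔞`, up to a constant:
`h_ν(τ)` is `g_μ ‖ₖ diag(1, ξ)`, where `ξ ≫ 0` generates `t_μ t_ν⁻¹ 𝔞⁻¹`; thus `C_𝐡(𝔪)` is
proportional to `C_𝐠(𝔞⁻¹𝔪)`. -/
def IsLevelRaise (𝔞 : Ideal (𝓞 F)) (g h : Family F) : Prop :=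
  ∀ (ν μ : NarrowClassGroup F) (ξ : Fˣ), TotPos (ξ : F) →
    FractionalIdeal.spanSingleton (𝓞 F)⁰ (ξ : F) * ((t ν : FractionalIdeal (𝓞 F)⁰ F) * 𝔞) = t μ →
    h ν = slash k (g μ) (Matrix.GeneralLinearGroup.mkOfDetNeZero !![1, 0; 0, (ξ : F)] (by simp))

/-- `𝔖_k^old(𝔫)`: the span of the forms that come from lower levels. -/
def oldSpace : Submodule ℂ (Family F) :=
  Submodule.span ℂ {h | ∃ (𝔠 𝔞 : Ideal (𝓞 F)) (g : Family F), 𝔠 * 𝔞 ∣ 𝔫 ∧ 𝔠 ≠ 𝔫 ∧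
    IsHilbertCuspForm t k 𝔠 g ∧ IsLevelRaise t k 𝔞 g h}

/-- `𝐟 ∈ 𝔖_k^new(𝔫)`: orthogonal to the old forms for the Petersson product. -/
def IsNewform (f : Family F) : Prop :=
  IsHilbertCuspForm t k 𝔫 f ∧ ∀ h ∈ oldSpace t k 𝔫,
    ∀ D, (∀ ν, IsFundDomain (Gamma (t ν) 𝔫) (D ν)) → petersson k D f h = 0

/-- `𝐟 ∈ 𝓕_k(𝔫)`: a primitive form of weight `k` and level `𝔫` (with trivial character), that is, a
new form which is an eigenfunction of all Hecke operators and satisfies `C_𝐟(𝓞) = 1`. -/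
structure IsPrimitive (f : Family F) : Prop where
  new : IsNewform t k 𝔫 f
  trivial_character : HasTrivialCharacter t k 𝔫 f
  eigen : ∀ 𝔪 : Ideal (𝓞 F), 𝔪 ≠ ⊥ → ∃ c : ℂ, hecke t k 𝔫 𝔪 f = c • f
  normalized : coeffC t k f ⊤ = 1

/-- `θ = θ_𝔭 ∈ [0, π]` is the Hecke eigenangle at `𝔭`: `c_𝐟(𝔭) = 2 cos θ`. -/
def IsHeckeAngle (f : Family F) (𝔭 : Ideal (𝓞 F)) (θ : ℝ) : Prop :=
  θ ∈ Set.Icc 0 Real.pi ∧ normCoeff t k f 𝔭 = ((2 * Real.cos θ : ℝ) : ℂ)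

end adelic

/-- `‖x‖`, the distance from `x` to the nearest integer. -/
def distInt (x : ℝ) : ℝ := |x - round x|

/-- `η > 0` and `‖q α‖ > η / q` for all positive integers `q`. -/
def IsBadApproxConst (η α : ℝ) : Prop := 0 < η ∧ ∀ q : ℕ, 1 ≤ q → η / q < distInt (q * α)

/-- `α` is badly approximable. -/
def BadlyApproximable (α : ℝ) : Prop := ∃ η, IsBadApproxConst η α

end HilbertForm

end

/-!
The Hecke operator `T_𝔭` is a sum over one class of matrices whose first column is divisible by
`𝔭`, which the trivial character moves to a diagonal matrix, and `N(𝔭)` classes of upper triangular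
matrices. Fourier coefficients are determined by the function, being mean values along horizontal
lines, so comparing those of `T_𝔭 f` and of `f` gives `c(𝔭) c(𝔪) = c(𝔭𝔪) + c(𝔪𝔭⁻¹)`, the
last term being absent if `𝔭 ∤ 𝔪`. Hence `c(𝔭ⁿ)` is the `n`-th Chebyshev polynomial of the second
kind at `cos θ`, that is `sin ((n + 1) θ) / sin θ`. Since `|sin (πx)| ≥ 2‖x‖` and `|sin θ| ≤ 1`, its
absolute value is at least `2 ‖(n + 1) θ / π‖`.
-/

noncomputable section

namespace HilbertForm

section TrigonometricSeries

open Filter Topology Complex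

lemma norm_interval_average_le {E : Type*} [NormedAddCommGroup E] [NormedSpace ℝ E] {g : ℝ → E}
    {C : ℝ} (hg : ∀ s, ‖g s‖ ≤ C) (a b : ℝ) : ‖⨍ s in a..b, g s‖ ≤ C := by
  rw [interval_average_eq, norm_smul, norm_inv, Real.norm_eq_abs]
  exact inv_mul_le_of_le_mul₀ (abs_nonneg _) ((norm_nonneg _).trans (hg 0))
    ((intervalIntegral.norm_integral_le_of_norm_le_const fun s _ => hg s).trans_eq (mul_comm _ _))

lemma norm_integral_exp_le {r : ℝ} (hr : r ≠ 0) (T : ℝ) :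
    ‖∫ s in (0 : ℝ)..T, exp (Complex.I * (r * s : ℝ))‖ ≤ 2 / |r| := by
  have hc : Complex.I * (r : ℂ) ≠ 0 := mul_ne_zero I_ne_zero (ofReal_ne_zero.mpr hr)
  simp_rw [ofReal_mul, ← mul_assoc]
  rw [integral_exp_mul_complex hc, mul_assoc, mul_assoc, ← ofReal_mul, ← ofReal_mul, norm_div,
    norm_mul, norm_I, one_mul, norm_real, Real.norm_eq_abs]
  gcongr
  refine (norm_sub_le _ _).trans_eq ?_
  rw [norm_exp_I_mul_ofReal, norm_exp_I_mul_ofReal, one_add_one_eq_two]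

lemma tendsto_interval_average_exp (r : ℝ) :
    Tendsto (fun T : ℝ => ⨍ s in (0 : ℝ)..T, exp (Complex.I * (r * s : ℝ))) atTop
      (𝓝 (if r = 0 then 1 else 0)) := by
  simp_rw [interval_average_eq, sub_zero]
  split_ifs with hr
  · refine tendsto_const_nhds.congr' ?_
    filter_upwards [eventually_ne_atTop 0] with T hT
    simp [hr, hT]
  · refine squeeze_zero_norm' (a := fun T : ℝ => T⁻¹ * (2 / |r|)) ?_ ?_
    · filter_upwards [eventually_ge_atTop 0] with T hT
      rw [norm_smul, norm_inv, Real.norm_of_nonneg hT]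
      gcongr
      exact norm_integral_exp_le hr T
    · simpa using tendsto_inv_atTop_zero.mul_const (2 / |r|)

variable {ι : Type*} [Countable ι] {d : ι → ℂ} {φ : ι → ℝ} {g : ℝ → ℂ}

lemma hasSum_interval_average_exp (hd : Summable d)
    (hg : ∀ s : ℝ, HasSum (fun i => d i * exp (Complex.I * (φ i * s : ℝ))) (g s)) (a b : ℝ) :
    HasSum (fun i => d i * ⨍ s in a..b, exp (Complex.I * (φ i * s : ℝ))) (⨍ s in a..b, g s) := by
  have hint := intervalIntegral.hasSum_integral_of_dominated_convergence (μ := volume)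
    (a := a) (b := b) (f := g) (F := fun i (s : ℝ) => d i * exp (Complex.I * (φ i * s : ℝ)))
    (fun i _ => ‖d i‖)
    (fun i => (by fun_prop : Continuous _).aestronglyMeasurable)
    (fun i => .of_forall fun s _ => by rw [norm_mul, norm_exp_I_mul_ofReal, mul_one])
    (.of_forall fun s _ => hd.norm) (by simp)
    (.of_forall fun s _ => hg s)
  simp_rw [intervalIntegral.integral_const_mul] at hint
  simp_rw [interval_average_eq, mul_smul_comm]
  exact hint.const_smul _

lemma tendsto_interval_average_mul_exp_neg (hφ : Function.Injective φ)
    (hg : ∀ s : ℝ, HasSum (fun i => d i * exp (Complex.I * (φ i * s : ℝ))) (g s)) (j : ι) :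
    Tendsto (fun T : ℝ => ⨍ s in (0 : ℝ)..T, g s * exp (Complex.I * (-φ j * s : ℝ))) atTop
      (𝓝 (d j)) := by
  classical
  have hd : Summable d := by simpa using (hg 0).summable
  have hshift (s : ℝ) : HasSum (fun i => d i * exp (Complex.I * ((φ i - φ j) * s : ℝ)))
      (g s * exp (Complex.I * (-φ j * s : ℝ))) := by
    refine ((hg s).mul_right _).congr_fun fun i => ?_
    rw [mul_assoc (d i), ← exp_add]
    congr 2
    push_cast
    ring
  have hlim := tendsto_tsum_of_dominated_convergence (𝓕 := (atTop : Filter ℝ))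
    (f := fun T i => d i * ⨍ s in (0 : ℝ)..T, exp (Complex.I * ((φ i - φ j) * s : ℝ)))
    (g := fun i => d i * if φ i - φ j = 0 then 1 else 0) hd.norm
    (fun i => (tendsto_interval_average_exp _).const_mul _)
    (.of_forall fun T i => by
      rw [norm_mul]
      refine mul_le_of_le_one_right (norm_nonneg _) (norm_interval_average_le (fun s => ?_) _ _)
      rw [norm_exp_I_mul_ofReal])
  simp_rw [(hasSum_interval_average_exp hd hshift _ _).tsum_eq, sub_eq_zero, hφ.eq_iff, mul_ite,
    mul_one, mul_zero, tsum_ite_eq] at hlim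
  exact hlim

lemma eq_of_hasSum_exp {d' : ι → ℂ} (hφ : Function.Injective φ)
    (hd : ∀ s : ℝ, HasSum (fun i => d i * exp (Complex.I * (φ i * s : ℝ))) (g s))
    (hd' : ∀ s : ℝ, HasSum (fun i => d' i * exp (Complex.I * (φ i * s : ℝ))) (g s)) : d = d' :=
  funext fun j => tendsto_nhds_unique (tendsto_interval_average_mul_exp_neg hφ hd j)
    (tendsto_interval_average_mul_exp_neg hφ hd' j)

end TrigonometricSeries

section FractionalIdeals

open FractionalIdeal

variable {R K : Type*} [CommRing R] [Field K] [Algebra R K]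
  {A B C J : FractionalIdeal R⁰ K} {𝔞 𝔟 : Ideal R} {x y : K}

lemma add_mem_fractionalIdeal (hx : x ∈ A) (hy : y ∈ A) : x + y ∈ A := A.1.add_mem hx hy

lemma sub_mem_fractionalIdeal (hx : x ∈ A) (hy : y ∈ A) : x - y ∈ A := A.1.sub_mem hx hy

lemma mul_mem_of_mul_le (h : A * B ≤ C) (hx : x ∈ A) (hy : y ∈ B) : x * y ∈ C :=
  h (mul_mem_mul hx hy)

lemma algebraMap_mul_mem (r : R) (hx : x ∈ A) : algebraMap R K r * x ∈ A :=
  Algebra.smul_def r x ▸ A.1.smul_mem r hx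

lemma coeIdeal_mul_le (𝔞 : Ideal R) (B : FractionalIdeal R⁰ K) :
    (𝔞 : FractionalIdeal R⁰ K) * B ≤ B :=
  (mul_le_mul_left coeIdeal_le_one B).trans_eq (one_mul B)

lemma mem_coeIdeal_mul_of_isCoprime (h𝔞𝔟 : IsCoprime 𝔞 𝔟)
    (h𝔞 : x ∈ (𝔞 : FractionalIdeal R⁰ K) * B) (h𝔟 : x ∈ (𝔟 : FractionalIdeal R⁰ K) * B) :
    x ∈ (𝔞 : FractionalIdeal R⁰ K) * (𝔟 * B) := by
  obtain ⟨a, ha, b, hb, hab⟩ := Ideal.isCoprime_iff_exists.mp h𝔞𝔟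
  have hx : x = algebraMap R K a * x + algebraMap R K b * x := by
    rw [← add_mul, ← map_add, hab, map_one, one_mul]
  rw [hx]
  exact add_mem_fractionalIdeal (mul_mem_mul (mem_coeIdeal_of_mem _ ha) h𝔟)
    (mul_mem_of_mul_le (mul_left_comm _ _ _).le (mem_coeIdeal_of_mem _ hb) h𝔞)

variable [IsFractionRing R K]

lemma mem_of_spanSingleton_eq (h : spanSingleton R⁰ x = A) : x ∈ A :=
  h ▸ mem_spanSingleton_self _ _

lemma mem_coeIdeal_iff {r : R} : algebraMap R K r ∈ (𝔞 : FractionalIdeal R⁰ K) ↔ r ∈ 𝔞 :=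
  ⟨fun h => by
    obtain ⟨s, hs, hsr⟩ := (mem_coeIdeal _).mp h
    rwa [← IsFractionRing.injective R K hsr], mem_coeIdeal_of_mem _⟩

lemma mul_inv_mem_iff_of_spanSingleton_eq (hx : x ≠ 0) (h : spanSingleton R⁰ x = A) :
    y * x⁻¹ ∈ B ↔ y ∈ B * A := by
  rw [← h, mul_comm B, mem_singleton_mul]
  constructor
  · exact fun hy => ⟨_, hy, by field_simp⟩
  · rintro ⟨z, hz, rfl⟩
    rwa [mul_comm x, mul_inv_cancel_right₀ hx]

variable [IsDedekindDomain R]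

lemma mem_coeIdeal_mul_iff (hB : B ≠ 0) :
    x ∈ (𝔞 : FractionalIdeal R⁰ K) * B ↔ spanSingleton R⁰ x * B⁻¹ ≤ 𝔞 := by
  rw [← spanSingleton_le_iff_mem, mul_inv_le_iff₀ (pos_iff_ne_zero.mpr hB)]

lemma exists_coeIdeal_eq_spanSingleton_mul_inv (hB : B ≠ 0) (hx : x ∈ B) :
    ∃ 𝔠 : Ideal R, (𝔠 : FractionalIdeal R⁰ K) = spanSingleton R⁰ x * B⁻¹ := by
  refine le_one_iff_exists_coeIdeal.mp ?_
  rw [← coeIdeal_top, ← mem_coeIdeal_mul_iff hB]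
  simpa using hx

lemma exists_coeIdeal_eq_spanSingleton_mul_inv_add {c : K} (hB : B ≠ 0) (hc0 : c ≠ 0)
    (hc : c ∈ (𝔞 : FractionalIdeal R⁰ K) * B) :
    ∃ a ∈ 𝔞, (𝔞 : FractionalIdeal R⁰ K) =
      spanSingleton R⁰ c * B⁻¹ + (Ideal.span {a} : Ideal R) := by
  obtain ⟨𝔠, h𝔠⟩ := exists_coeIdeal_eq_spanSingleton_mul_inv hB (coeIdeal_mul_le 𝔞 B hc)
  have h𝔠0 : 𝔠 ≠ ⊥ := by
    rw [← coeIdeal_ne_zero (K := K), h𝔠]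
    exact mul_ne_zero (spanSingleton_ne_zero_iff.mpr hc0) (inv_ne_zero hB)
  rw [mem_coeIdeal_mul_iff hB, ← h𝔠, coeIdeal_le_coeIdeal] at hc
  obtain ⟨a, ha⟩ := IsDedekindDomain.exists_sup_span_eq hc h𝔠0
  refine ⟨a, ha ▸ Ideal.mem_sup_right (Ideal.mem_span_singleton_self a), ?_⟩
  rw [← h𝔠, ← coeIdeal_sup, ha]

variable {𝔭 : Ideal R}

lemma not_le_coeIdeal_mul (h𝔭 : 𝔭 ≠ ⊤) (hJ : J ≠ 0) : ¬ J ≤ 𝔭 * J := fun h => by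
  have h1 : (𝔭 : FractionalIdeal R⁰ K) = 1 :=
    mul_right_cancel₀ hJ ((coeIdeal_mul_le 𝔭 J).antisymm h |>.trans (one_mul J).symm)
  exact h𝔭 ((coeIdeal_eq_one.mp h1).trans Ideal.one_eq_top)

lemma exists_one_sub_mul_mem (h𝔭 : 𝔭.IsMaximal) (hB : B ≠ 0) (hx : x ∈ B)
    (hx' : x ∉ (𝔭 : FractionalIdeal R⁰ K) * B) :
    ∃ y ∈ B⁻¹, 1 - x * y ∈ (𝔭 : FractionalIdeal R⁰ K) := by
  obtain ⟨𝔠, h𝔠⟩ := exists_coeIdeal_eq_spanSingleton_mul_inv hB hx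
  rw [mem_coeIdeal_mul_iff hB, ← h𝔠, coeIdeal_le_coeIdeal] at hx'
  obtain ⟨v, hv, u, hu, hvu⟩ :=
    Submodule.mem_sup.mp ((Ideal.eq_top_iff_one _).mp (h𝔭.1.2 _ (left_lt_sup.mpr hx')))
  have hu' := mem_coeIdeal_of_mem (P := K) R⁰ hu
  rw [h𝔠, mem_singleton_mul] at hu'
  obtain ⟨y, hy, huy⟩ := hu'
  refine ⟨y, hy, ?_⟩
  rw [← huy, ← map_one (algebraMap R K), ← hvu, map_add, add_sub_cancel_right]
  exact mem_coeIdeal_of_mem _ hv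

lemma sub_mul_mem_coeIdeal_mul_iff {b : K} (hJ : J ≠ 0) (hx : x ∈ J) (hy : y ∈ J⁻¹)
    (hxy : 1 - x * y ∈ (𝔭 : FractionalIdeal R⁰ K)) (hb : b ∈ J) (r : R) :
    b - algebraMap R K r * x ∈ (𝔭 : FractionalIdeal R⁰ K) * J ↔
      b * y - algebraMap R K r ∈ (𝔭 : FractionalIdeal R⁰ K) := by
  have hpJ : (𝔭 : FractionalIdeal R⁰ K) * J * J⁻¹ ≤ 𝔭 := by rw [mul_inv_cancel_right₀ hJ]
  constructor <;> intro h
  · have := sub_mem_fractionalIdeal (mul_mem_of_mul_le hpJ h hy) (algebraMap_mul_mem r hxy)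
    convert this using 1
    ring
  · convert add_mem_fractionalIdeal (mul_mem_mul hxy hb) (mul_mem_mul h hx) using 1
    ring

lemma exists_residue_system (h𝔭 : 𝔭.IsMaximal) (hJ : J ≠ 0) :
    ∃ B : R ⧸ 𝔭 → K, (∀ x, B x ∈ J) ∧
      ∀ b ∈ J, ∃! x, b - B x ∈ (𝔭 : FractionalIdeal R⁰ K) * J := by
  obtain ⟨j, hj, hj'⟩ := Set.not_subset.mp (not_le_coeIdeal_mul h𝔭.ne_top hJ)
  obtain ⟨y, hy, hjy⟩ := exists_one_sub_mul_mem h𝔭 hJ hj hj'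
  obtain ⟨rep, hrep⟩ := (Ideal.Quotient.mk_surjective (I := 𝔭)).hasRightInverse
  refine ⟨fun x => algebraMap R K (rep x) * j, fun x => algebraMap_mul_mem _ hj, fun b hb => ?_⟩
  obtain ⟨s, hs⟩ := (mem_one_iff _).mp (mul_mem_of_mul_le (mul_inv_cancel₀ hJ).le hb hy)
  have hiff (x : R ⧸ 𝔭) : b - algebraMap R K (rep x) * j ∈ (𝔭 : FractionalIdeal R⁰ K) * J ↔
      x = Ideal.Quotient.mk 𝔭 s := by
    rw [sub_mul_mem_coeIdeal_mul_iff hJ hj hy hjy hb, ← hs, ← map_sub, mem_coeIdeal_iff,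
      ← Ideal.Quotient.eq, hrep, eq_comm]
  simp only [hiff, existsUnique_eq]

lemma exists_mul_sub_mul_eq {𝔫 : Ideal R} {E : FractionalIdeal R⁰ K} {δ : K}
    (h𝔭𝔫 : IsCoprime 𝔭 𝔫) (h𝔭 : 𝔭 ≠ ⊥) (h𝔫 : 𝔫 ≠ ⊥) (hB : B ≠ 0)
    (hδ : δ ∈ (𝔭 : FractionalIdeal R⁰ K) * E) :
    ∃ a ∈ 𝔭, ∃ b ∈ B⁻¹ * E, ∃ c ∈ (𝔭 : FractionalIdeal R⁰ K) * (𝔫 * B), ∃ d ∈ E,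
      Ideal.span {a} ⊔ 𝔫 = ⊤ ∧ algebraMap R K a * d - b * c = δ := by
  have hJ : (𝔭 : FractionalIdeal R⁰ K) * (𝔫 * B) ≠ 0 :=
    mul_ne_zero (coeIdeal_ne_zero.mpr h𝔭) (mul_ne_zero (coeIdeal_ne_zero.mpr h𝔫) hB)
  obtain ⟨c, hc, hc0⟩ : ∃ c ∈ (𝔭 : FractionalIdeal R⁰ K) * (𝔫 * B), c ≠ 0 := by
    by_contra! h
    exact hJ (eq_zero_iff.mpr h)
  have hc𝔫 : spanSingleton R⁰ c * B⁻¹ ≤ 𝔫 :=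
    (mem_coeIdeal_mul_iff hB).mp (coeIdeal_mul_le 𝔭 _ hc)
  have hc𝔭 : c ∈ (𝔭 : FractionalIdeal R⁰ K) * B :=
    coeIdeal_mul_le 𝔫 _ ((mul_left_comm _ _ B).le hc)
  obtain ⟨a, ha, h𝔭a⟩ := exists_coeIdeal_eq_spanSingleton_mul_inv_add hB hc0 hc𝔭
  have h𝔭le : 𝔭 ≤ Ideal.span {a} ⊔ 𝔫 := by
    rw [← coeIdeal_le_coeIdeal K, coeIdeal_sup, h𝔭a, add_comm]
    exact add_le_add_right hc𝔫 _
  have ha𝔫 : Ideal.span {a} ⊔ 𝔫 = ⊤ :=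
    top_le_iff.mp (h𝔭𝔫.sup_eq ▸ sup_le h𝔭le le_sup_right)
  rw [h𝔭a, add_mul, mul_assoc, coeIdeal_span_singleton, mem_add] at hδ
  obtain ⟨_, hu, _, hv, huv⟩ := hδ
  obtain ⟨b, hb, rfl⟩ := mem_singleton_mul.mp hu
  obtain ⟨d, hd, rfl⟩ := mem_singleton_mul.mp hv
  refine ⟨a, ha, -b, (B⁻¹ * E).1.neg_mem hb, c, hc, d, hd, ha𝔫, ?_⟩
  rw [← huv]
  ring

lemma exists_one_sub_mul_add_mul_mem {𝔫 : Ideal R} {a c : K} (h𝔭 : 𝔭.IsMaximal)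
    (h𝔭𝔫 : IsCoprime 𝔭 𝔫) (hB : B ≠ 0) (ha : a ∈ (1 : FractionalIdeal R⁰ K))
    (hc : c ∈ (𝔫 : FractionalIdeal R⁰ K) * B)
    (hac : ¬ (a ∈ (𝔭 : FractionalIdeal R⁰ K) ∧ c ∈ (𝔭 : FractionalIdeal R⁰ K) * (𝔫 * B))) :
    ∃ x ∈ (1 : FractionalIdeal R⁰ K), ∃ y ∈ B⁻¹,
      1 - (a * x + c * y) ∈ (𝔭 : FractionalIdeal R⁰ K) := by
  by_cases ha' : a ∈ (𝔭 : FractionalIdeal R⁰ K)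
  · obtain ⟨y, hy, hcy⟩ := exists_one_sub_mul_mem h𝔭 hB (coeIdeal_mul_le 𝔫 B hc)
      fun hc' => hac ⟨ha', mem_coeIdeal_mul_of_isCoprime h𝔭𝔫 hc' hc⟩
    exact ⟨0, FractionalIdeal.zero_mem _, y, hy, by simpa using hcy⟩
  · obtain ⟨x, hx, hax⟩ := exists_one_sub_mul_mem h𝔭 (one_ne_zero' (FractionalIdeal R⁰ K)) ha
      (by simpa using ha')
    exact ⟨x, by simpa using hx, 0, FractionalIdeal.zero_mem _, by simpa using hax⟩

end FractionalIdeals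

section Traces

variable {F : Type*} [Field F] [NumberField F]

lemma countable_numberField : Countable F :=
  (Module.finBasis ℚ F).equivFun.toEquiv.countable_iff.mpr inferInstance

lemma dual_inv_mul_different (T : FractionalIdeal (𝓞 F)⁰ F) :
    FractionalIdeal.dual ℤ ℚ (T * different F)⁻¹ = T := by
  have h1 : FractionalIdeal.dual ℤ ℚ (1 : FractionalIdeal (𝓞 F)⁰ F) = (different F)⁻¹ := by
    rw [different, coeIdeal_differentIdeal ℤ ℚ F (𝓞 F), inv_inv]
  rw [FractionalIdeal.dual_eq_mul_inv, h1, inv_inv, mul_comm T,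
    inv_mul_cancel_left₀ different_ne_zero]

/-- The additive character `x ↦ exp(2πi Tr x)` of a totally real field, with the trace written as
the sum of the real embeddings. -/
def traceChar (x : F) : ℂ :=
  Complex.exp (2 * Real.pi * Complex.I * (∑ σ : F →+* ℝ, σ x : ℝ))

lemma traceChar_zero : traceChar (0 : F) = 1 := by simp [traceChar]

variable [IsTotallyReal F]

/-- The real embeddings of a totally real field, identified with its complex embeddings. -/
def realEmbeddingEquiv : (F →+* ℝ) ≃ (F →ₐ[ℚ] ℂ) :=
  (Equiv.ofBijective (fun σ : F →+* ℝ => Complex.ofRealHom.comp σ)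
    ⟨fun σ τ h => by
      ext x
      simpa using RingHom.congr_fun h x,
    fun φ => ⟨(IsTotallyReal.complexEmbedding_isReal φ).embedding, by ext x; simp⟩⟩).trans
  (RingHom.equivRatAlgHom F ℂ)

lemma nonempty_realEmbedding : Nonempty (F →+* ℝ) :=
  (realEmbeddingEquiv (F := F)).nonempty_congr.mpr ⟨(Classical.arbitrary (F →+* ℂ)).toRatAlgHom⟩

lemma sum_realEmbedding_eq_trace (x : F) :
    ∑ σ : F →+* ℝ, σ x = (Algebra.trace ℚ F x : ℚ) := by
  have h := trace_eq_sum_embeddings (K := ℚ) (L := F) ℂ (x := x)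
  rw [← Equiv.sum_comp (realEmbeddingEquiv (F := F)), eq_ratCast] at h
  have hσ (σ : F →+* ℝ) : realEmbeddingEquiv σ x = ((σ x : ℝ) : ℂ) := rfl
  simp_rw [hσ] at h
  exact_mod_cast h.symm

lemma traceChar_eq_one_iff {x : F} : traceChar x = 1 ↔ ∃ n : ℤ, (n : ℚ) = Algebra.trace ℚ F x := by
  rw [traceChar, sum_realEmbedding_eq_trace, Complex.exp_eq_one_iff]
  refine exists_congr fun n => ?_
  rw [mul_comm (n : ℂ), mul_right_inj' Complex.two_pi_I_ne_zero, eq_comm]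
  norm_cast

lemma mem_iff_traceChar_mul_eq_one {T : FractionalIdeal (𝓞 F)⁰ F} (hT : T ≠ 0) {ξ : F} :
    ξ ∈ T ↔ ∀ b ∈ (T * different F)⁻¹, traceChar (ξ * b) = 1 := by
  have hJ : (T * different F)⁻¹ ≠ 0 := inv_ne_zero (mul_ne_zero hT different_ne_zero)
  nth_rewrite 1 [← dual_inv_mul_different T]
  simp only [FractionalIdeal.mem_dual hJ, traceChar_eq_one_iff, Algebra.traceForm_apply,
    RingHom.mem_range, eq_intCast]

end Traces

section Action

variable {F : Type*} [Field F]

lemma moebius_one (τ : HalfSpace F) : moebius 1 τ = τ := by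
  funext σ
  simp only [moebius, map_one, one_smul]

lemma moebius_mul (α β : GL (Fin 2) F) (τ : HalfSpace F) :
    moebius (α * β) τ = moebius α (moebius β τ) := by
  funext σ
  simp only [moebius, map_mul, mul_smul]

lemma TotPos.det_map_pos {β : GL (Fin 2) F} (hβ : TotPos β.1.det) (σ : F →+* ℝ) :
    0 < (Matrix.GeneralLinearGroup.map σ β).det.val :=
  (RingHom.map_det σ β.1 ▸ hβ σ :)

/-- The matrix `(1, b; 0, d)`: translations and diagonal elements of `Gamma`, and representatives of
the cosets of a Hecke operator, have this form. -/
def upperTri (b : F) (d : Fˣ) : GL (Fin 2) F :=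
  Matrix.GeneralLinearGroup.mkOfDetNeZero !![1, b; 0, (d : F)] (by simp)

lemma upperTri_val (b : F) (d : Fˣ) : (upperTri b d).1 = !![1, b; 0, (d : F)] := rfl

lemma det_upperTri (b : F) (d : Fˣ) : (upperTri b d).1.det = d := by
  simp [upperTri_val]

variable [NumberField F] (k : (F →+* ℝ) → ℕ)

lemma slash_one (f : HalfSpace F → ℂ) : slash k f 1 = f := by
  funext τ
  simp [slash, moebius_one]

lemma slash_mul (f : HalfSpace F → ℂ) {α β : GL (Fin 2) F} (hα : TotPos α.1.det)
    (hβ : TotPos β.1.det) : slash k f (α * β) = slash k (slash k f α) β := by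
  funext τ
  have hdenom (γ : GL (Fin 2) F) (τ : HalfSpace F) (σ : F →+* ℝ) :
      (σ (γ.1 1 0) : ℂ) * (τ σ : ℂ) + (σ (γ.1 1 1) : ℂ) =
        denom (Matrix.GeneralLinearGroup.map σ γ) (τ σ) := rfl
  have hcocycle (σ : F →+* ℝ) : denom (Matrix.GeneralLinearGroup.map σ (α * β)) (τ σ) =
      denom (Matrix.GeneralLinearGroup.map σ α) (moebius β τ σ) *
        denom (Matrix.GeneralLinearGroup.map σ β) (τ σ) := by
    rw [map_mul, denom_cocycle _ _ (τ σ).im_ne_zero, moebius,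
      coe_smul_of_det_pos (hβ.det_map_pos σ)]
  have hdet (σ : F →+* ℝ) : (σ (α * β).1.det) ^ ((k σ : ℝ) / 2) =
      (σ α.1.det) ^ ((k σ : ℝ) / 2) * (σ β.1.det) ^ ((k σ : ℝ) / 2) := by
    rw [Units.val_mul, Matrix.det_mul, map_mul, Real.mul_rpow (hα σ).le (hβ σ).le]
  simp only [slash, hdenom, hcocycle, hdet, moebius_mul, mul_pow, Complex.ofReal_mul,
    Finset.prod_mul_distrib, mul_inv]
  ring

lemma slash_eq_of_mul_inv_mem {f : HalfSpace F → ℂ} {Γ : Subgroup (GL (Fin 2) F)}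
    (hf : ∀ γ ∈ Γ, slash k f γ = f) (hΓ : ∀ γ ∈ Γ, TotPos γ.1.det) {α β : GL (Fin 2) F}
    (hβ : TotPos β.1.det) (h : α * β⁻¹ ∈ Γ) : slash k f α = slash k f β := by
  rw [← inv_mul_cancel_right α β, slash_mul k f (hΓ _ h) hβ, hf _ h]

/-- The factor `ξ^{-k/2} = ∏ⱼ ξⱼ^{-kⱼ/2}` in the normalization of Fourier coefficients; the
exponents are real, so it is meaningful only for `ξ ≫ 0`. -/
def weightFactor (ξ : F) : ℂ := ∏ σ : F →+* ℝ, (((σ ξ) ^ (-(k σ : ℝ) / 2) : ℝ) : ℂ)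

lemma weightFactor_mul {x y : F} (hx : TotPos x) (hy : TotPos y) :
    weightFactor k (x * y) = weightFactor k x * weightFactor k y := by
  rw [weightFactor, weightFactor, weightFactor, ← Finset.prod_mul_distrib]
  refine Finset.prod_congr rfl fun σ _ => ?_
  rw [map_mul, Real.mul_rpow (hx σ).le (hy σ).le, Complex.ofReal_mul]

lemma slash_upperTri (f : HalfSpace F → ℂ) (b : F) {d : Fˣ} (hd : TotPos (d : F))
    (τ : HalfSpace F) :
    slash k f (upperTri b d) τ = weightFactor k (d : F) * f (moebius (upperTri b d) τ) := by
  rw [slash, det_upperTri, ← Finset.prod_inv_distrib, ← Finset.prod_mul_distrib, weightFactor]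
  congr 1
  refine Finset.prod_congr rfl fun σ _ => ?_
  have hpow : (σ d) ^ (-(k σ : ℝ) / 2) = (σ d) ^ ((k σ : ℝ) / 2) * ((σ d) ^ (k σ))⁻¹ := by
    rw [← Real.rpow_natCast, ← Real.rpow_neg (hd σ).le, ← Real.rpow_add (hd σ)]
    congr 1
    ring
  simp [hpow, upperTri_val]

lemma expTrace_moebius_upperTri (b : F) {d : Fˣ} (hd : TotPos (d : F)) (ξ : F) (τ : HalfSpace F) :
    expTrace (d * ξ) (moebius (upperTri b d) τ) = traceChar (ξ * b) * expTrace ξ τ := by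
  have hτ (σ : F →+* ℝ) : (moebius (upperTri b d) τ σ : ℂ) = ((τ σ : ℂ) + σ b) / σ d := by
    rw [moebius, coe_smul_of_det_pos (TotPos.det_map_pos (by rwa [det_upperTri]) σ)]
    simp [num, denom, upperTri_val]
  simp only [expTrace, traceChar, ← Complex.exp_add, hτ, ← mul_add, Complex.ofReal_sum,
    ← Finset.sum_add_distrib]
  congr 2
  refine Finset.sum_congr rfl fun σ _ => ?_
  have hσd : (σ d : ℂ) ≠ 0 := by exact_mod_cast (hd σ).ne'
  push_cast [map_mul]
  field_simp
  ring

lemma hasSum_slash_upperTri {f : HalfSpace F → ℂ} {a : F → ℂ}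
    (ha : ∀ τ, HasSum (fun ξ : F => a ξ * expTrace ξ τ) (f τ)) (b : F) {d : Fˣ}
    (hd : TotPos (d : F)) (τ : HalfSpace F) :
    HasSum (fun ξ : F => weightFactor k (d : F) * traceChar (ξ * b) * a (d * ξ) * expTrace ξ τ)
      (slash k f (upperTri b d) τ) := by
  rw [slash_upperTri k f b hd]
  refine (((Units.mulLeft d).hasSum_iff.mpr (ha _)).mul_left _).congr_fun fun ξ => ?_
  rw [Function.comp_apply, Units.mulLeft_apply, expTrace_moebius_upperTri b hd]
  ring

end Action

section FourierExpansions

variable {F : Type*} [Field F] [NumberField F]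

lemma expTrace_update_vadd [DecidableEq (F →+* ℝ)] (ξ : F) (τ : HalfSpace F) (σ : F →+* ℝ)
    (s : ℝ) :
    expTrace ξ (Function.update τ σ (s +ᵥ τ σ)) =
      expTrace ξ τ * Complex.exp (Complex.I * (2 * Real.pi * σ ξ * s : ℝ)) := by
  have hτ (ρ : F →+* ℝ) : ((Function.update τ σ (s +ᵥ τ σ) ρ : ℍ) : ℂ) =
      (τ ρ : ℂ) + if ρ = σ then (s : ℂ) else 0 := by
    by_cases h : ρ = σ
    · subst h
      simp [add_comm]
    · simp [h]
  simp only [expTrace, ← Complex.exp_add, hτ, mul_add, Finset.sum_add_distrib, mul_ite, mul_zero,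
    Finset.sum_ite_eq', Finset.mem_univ, if_true]
  push_cast
  ring_nf

/-- Restricting to a horizontal line in one coordinate turns a Fourier expansion into a
trigonometric series, whose frequencies are distinct since embeddings are injective. -/
lemma eq_of_hasSum_expTrace [IsTotallyReal F] {f : HalfSpace F → ℂ} {a b : F → ℂ}
    (ha : ∀ τ, HasSum (fun ξ : F => a ξ * expTrace ξ τ) (f τ))
    (hb : ∀ τ, HasSum (fun ξ : F => b ξ * expTrace ξ τ) (f τ)) : a = b := by
  classical
  obtain ⟨σ⟩ := nonempty_realEmbedding (F := F)
  have := countable_numberField (F := F)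
  let τ : HalfSpace F := fun _ => UpperHalfPlane.I
  have hline {d : F → ℂ} (hd : ∀ τ, HasSum (fun ξ : F => d ξ * expTrace ξ τ) (f τ)) (s : ℝ) :
      HasSum (fun ξ => d ξ * expTrace ξ τ * Complex.exp (Complex.I * (2 * Real.pi * σ ξ * s : ℝ)))
        (f (Function.update τ σ (s +ᵥ τ σ))) := by
    simpa only [expTrace_update_vadd, ← mul_assoc] using hd (Function.update τ σ (s +ᵥ τ σ))
  have hfreq : Function.Injective fun ξ : F => 2 * Real.pi * σ ξ :=
    fun x y h => σ.injective (mul_left_cancel₀ (by positivity) h)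
  funext ξ
  exact mul_right_cancel₀ (Complex.exp_ne_zero _)
    (congrFun (eq_of_hasSum_exp hfreq (hline ha) (hline hb)) ξ)

variable {k : (F →+* ℝ) → ℕ} {Γ : Subgroup (GL (Fin 2) F)} {f : HalfSpace F → ℂ}

lemma IsModularForm.hasSum_fourierCoeff (hf : IsModularForm k Γ f) (τ : HalfSpace F) :
    HasSum (fun ξ : F => fourierCoeff f ξ * expTrace ξ τ) (f τ) := by
  obtain ⟨a, ha, -⟩ := hf.holo_cusps 1 (fun σ => by simp)
  rw [slash_one] at ha
  have h : ∃ a, HasFourierExpansion f a := ⟨a, ha⟩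
  simp only [fourierCoeff, dif_pos h]
  exact h.choose_spec.2 τ

variable {T : (FractionalIdeal (𝓞 F)⁰ F)ˣ} {𝔫 : Ideal (𝓞 F)}

lemma upperTri_mem_Gamma {b : F} (hb : b ∈ ((T : FractionalIdeal (𝓞 F)⁰ F) * different F)⁻¹)
    {d : Fˣ} (hd : TotPos (d : F)) (hd1 : FractionalIdeal.spanSingleton (𝓞 F)⁰ (d : F) = 1) :
    upperTri b d ∈ Gamma T 𝔫 :=
  ⟨by rwa [det_upperTri], by rwa [det_upperTri], by simp [upperTri_val],
    by simpa [upperTri_val] using hb, by simpa [upperTri_val] using FractionalIdeal.zero_mem _,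
    by simpa [upperTri_val] using mem_of_spanSingleton_eq hd1⟩

variable [IsTotallyReal F]

lemma IsModularForm.fourierCoeff_eq_of_upperTri_mem (hf : IsModularForm k Γ f) {b : F} {d : Fˣ}
    (hd : TotPos (d : F)) (hbd : upperTri b d ∈ Γ) (ξ : F) :
    fourierCoeff f ξ =
      weightFactor k (d : F) * traceChar (ξ * b) * fourierCoeff f (d * ξ) := by
  have h := hasSum_slash_upperTri k hf.hasSum_fourierCoeff b hd
  rw [hf.slash_eq _ hbd] at h
  exact congrFun (eq_of_hasSum_expTrace hf.hasSum_fourierCoeff h) ξ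

lemma IsModularForm.mem_of_fourierCoeff_ne_zero (hf : IsModularForm k (Gamma T 𝔫) f) {ξ : F}
    (hξ : fourierCoeff f ξ ≠ 0) : ξ ∈ (T : FractionalIdeal (𝓞 F)⁰ F) := by
  refine (mem_iff_traceChar_mul_eq_one T.ne_zero).mpr fun b hb => ?_
  have hone : TotPos ((1 : Fˣ) : F) := fun σ => by simp
  have h := hf.fourierCoeff_eq_of_upperTri_mem hone (upperTri_mem_Gamma hb hone (by simp)) ξ
  simpa [weightFactor, hξ, eq_comm] using h

lemma IsModularForm.fourierCoeff_mul_weightFactor_of_unit (hf : IsModularForm k (Gamma T 𝔫) f)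
    {d : Fˣ} (hd : TotPos (d : F)) (hd1 : FractionalIdeal.spanSingleton (𝓞 F)⁰ (d : F) = 1)
    {ξ : F} (hξ : TotPos ξ) :
    fourierCoeff f (d * ξ) * weightFactor k (d * ξ) = fourierCoeff f ξ * weightFactor k ξ := by
  rw [hf.fourierCoeff_eq_of_upperTri_mem hd
    (upperTri_mem_Gamma (FractionalIdeal.zero_mem _) hd hd1) ξ, weightFactor_mul k hd hξ,
    mul_zero, traceChar_zero]
  ring

end FourierExpansions

section Cosets

variable {F : Type*} [Field F]

lemma mul_inv_val_fin_two (β β' : GL (Fin 2) F) :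
    (β * β'⁻¹).1 =
      !![(β.1 0 0 * β'.1 1 1 - β.1 0 1 * β'.1 1 0) * β'.1.det⁻¹,
         (β.1 0 1 * β'.1 0 0 - β.1 0 0 * β'.1 0 1) * β'.1.det⁻¹;
         (β.1 1 0 * β'.1 1 1 - β.1 1 1 * β'.1 1 0) * β'.1.det⁻¹,
         (β.1 1 1 * β'.1 0 0 - β.1 1 0 * β'.1 0 1) * β'.1.det⁻¹] := by
  rw [Units.val_mul, Matrix.coe_units_inv, Matrix.inv_def, Ring.inverse_eq_inv',
    Matrix.adjugate_fin_two]
  ext i j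
  fin_cases i <;> fin_cases j <;> simp [Matrix.mul_apply, Fin.sum_univ_two] <;> ring

lemma det_mul_inv (β β' : GL (Fin 2) F) : (β * β'⁻¹).1.det = β.1.det * β'.1.det⁻¹ := by
  rw [Units.val_mul, Matrix.det_mul, Matrix.coe_units_inv, Matrix.det_nonsing_inv,
    Ring.inverse_eq_inv']

variable [NumberField F] {𝔫 : Ideal (𝓞 F)}

lemma mul_inv_mem_Gamma_iff {T : (FractionalIdeal (𝓞 F)⁰ F)ˣ} {β β' : GL (Fin 2) F}
    {I : FractionalIdeal (𝓞 F)⁰ F} (hβ : TotPos β.1.det) (hβ' : TotPos β'.1.det)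
    (hI : FractionalIdeal.spanSingleton (𝓞 F)⁰ β.1.det = I)
    (hI' : FractionalIdeal.spanSingleton (𝓞 F)⁰ β'.1.det = I) :
    β * β'⁻¹ ∈ Gamma T 𝔫 ↔
      β.1 0 0 * β'.1 1 1 - β.1 0 1 * β'.1 1 0 ∈ I ∧
      β.1 0 1 * β'.1 0 0 - β.1 0 0 * β'.1 0 1 ∈
        ((T : FractionalIdeal (𝓞 F)⁰ F) * different F)⁻¹ * I ∧
      β.1 1 0 * β'.1 1 1 - β.1 1 1 * β'.1 1 0 ∈
        (𝔫 : FractionalIdeal (𝓞 F)⁰ F) * (T * different F) * I ∧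
      β.1 1 1 * β'.1 0 0 - β.1 1 0 * β'.1 0 1 ∈ I := by
  have hdet0 : β'.1.det ≠ 0 := β'.det.ne_zero
  have hspan : FractionalIdeal.spanSingleton (𝓞 F)⁰ (β * β'⁻¹).1.det = 1 := by
    rw [det_mul_inv, ← FractionalIdeal.spanSingleton_mul_spanSingleton,
      ← FractionalIdeal.spanSingleton_inv, hI, hI', mul_inv_cancel₀]
    exact hI' ▸ FractionalIdeal.spanSingleton_ne_zero_iff.mpr hdet0
  have hpos : TotPos (β * β'⁻¹).1.det := det_mul_inv β β' ▸ hβ.mul hβ'.inv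
  refine (and_iff_right hpos).trans ((and_iff_right hspan).trans ?_)
  simp only [mul_inv_val_fin_two β β', Matrix.of_apply, Matrix.cons_val',
    Matrix.cons_val_zero, Matrix.cons_val_one, Matrix.cons_val_fin_one,
    mul_inv_mem_iff_of_spanSingleton_eq hdet0 hI', one_mul]

variable {t : NarrowClassGroup F → (FractionalIdeal (𝓞 F)⁰ F)ˣ} {ν μ : NarrowClassGroup F}
  {𝔪 : Ideal (𝓞 F)}

/-- The units `δ ≫ 0` generating `𝔪t_μt_ν⁻¹`: the possible determinants of the matrices in
`heckeSet t 𝔫 𝔪 ν μ`. -/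
structure IsHeckeDet (t : NarrowClassGroup F → (FractionalIdeal (𝓞 F)⁰ F)ˣ) (𝔪 : Ideal (𝓞 F))
    (ν μ : NarrowClassGroup F) (δ : Fˣ) : Prop where
  totPos : TotPos (δ : F)
  span_eq : FractionalIdeal.spanSingleton (𝓞 F)⁰ (δ : F) =
    (𝔪 : FractionalIdeal (𝓞 F)⁰ F) * (t μ * (t ν)⁻¹ : (FractionalIdeal (𝓞 F)⁰ F)ˣ)

lemma isHeckeDet_of_mem_heckeSet {β : GL (Fin 2) F} (hβ : β ∈ heckeSet t 𝔫 𝔪 ν μ) :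
    IsHeckeDet t 𝔪 ν μ β.det :=
  ⟨hβ.1, hβ.2.1⟩

lemma IsHeckeDet.upperTri_mem_heckeSet {δ : Fˣ} (hδ : IsHeckeDet t 𝔪 ν μ δ) {b : F}
    (hb : b ∈ ((t ν : FractionalIdeal (𝓞 F)⁰ F) * different F)⁻¹) :
    upperTri b δ ∈ heckeSet t 𝔫 𝔪 ν μ :=
  ⟨by rw [det_upperTri]; exact hδ.totPos, by rw [det_upperTri, hδ.span_eq],
    ⟨1, by simp [upperTri_val], by simp⟩, by simpa [upperTri_val] using hb,
    by simpa [upperTri_val] using FractionalIdeal.zero_mem _,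
    by simpa [upperTri_val] using coeIdeal_mul_le 𝔪 _ (mem_of_spanSingleton_eq hδ.span_eq)⟩

lemma inv_mul_different_mul_div (T S : (FractionalIdeal (𝓞 F)⁰ F)ˣ) :
    ((S : FractionalIdeal (𝓞 F)⁰ F) * different F)⁻¹ *
      (S * T⁻¹ : (FractionalIdeal (𝓞 F)⁰ F)ˣ) = (T * different F)⁻¹ := by
  have hS := S.ne_zero
  push_cast
  field_simp

lemma mul_inv_upperTri_mem_Gamma_iff {β : GL (Fin 2) F} (hβ : β ∈ heckeSet t 𝔫 𝔪 ν μ) {δ : Fˣ}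
    (hδ : IsHeckeDet t 𝔪 ν μ δ) (b : F) :
    β * (upperTri b δ)⁻¹ ∈ Gamma (t μ) 𝔫 ↔
      β.1 0 1 - β.1 0 0 * b ∈
        (𝔪 : FractionalIdeal (𝓞 F)⁰ F) * ((t ν : FractionalIdeal (𝓞 F)⁰ F) * different F)⁻¹ ∧
      β.1 1 1 - β.1 1 0 * b ∈
        (𝔪 : FractionalIdeal (𝓞 F)⁰ F) * (t μ * (t ν)⁻¹ : (FractionalIdeal (𝓞 F)⁰ F)ˣ) := by
  obtain ⟨hdet, hspan, ⟨a, ha, -⟩, -, hc, -⟩ := hβ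
  have hδmem := mem_of_spanSingleton_eq hδ.span_eq
  rw [mul_inv_mem_Gamma_iff hdet (by rw [det_upperTri]; exact hδ.totPos) hspan
    (by rw [det_upperTri, hδ.span_eq]), mul_left_comm ((_ * different F)⁻¹),
    inv_mul_different_mul_div]
  simp only [upperTri_val, Matrix.of_apply, Matrix.cons_val', Matrix.cons_val_zero,
    Matrix.cons_val_one, Matrix.cons_val_fin_one, mul_zero, sub_zero, mul_one, ha,
    algebraMap_mul_mem a hδmem, FractionalIdeal.mul_mem_mul hc hδmem, true_and]

lemma IsHeckeDet.upperTri_mul_inv_mem_Gamma_iff {δ : Fˣ} (hδ : IsHeckeDet t 𝔪 ν μ δ) {b b' : F}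
    (hb : b ∈ ((t ν : FractionalIdeal (𝓞 F)⁰ F) * different F)⁻¹) :
    upperTri b δ * (upperTri b' δ)⁻¹ ∈ Gamma (t μ) 𝔫 ↔
      b - b' ∈ (𝔪 : FractionalIdeal (𝓞 F)⁰ F) *
        ((t ν : FractionalIdeal (𝓞 F)⁰ F) * different F)⁻¹ := by
  rw [mul_inv_upperTri_mem_Gamma_iff (hδ.upperTri_mem_heckeSet hb) hδ]
  simp only [upperTri_val, Matrix.of_apply, Matrix.cons_val', Matrix.cons_val_zero,
    Matrix.cons_val_one, Matrix.cons_val_fin_one, zero_mul, sub_zero, one_mul,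
    mem_of_spanSingleton_eq hδ.span_eq, and_true]

variable {𝔭 : Ideal (𝓞 F)}

/-- The matrices in `heckeSet t 𝔫 𝔭 ν μ` whose first column is divisible by `𝔭`. They form the one
coset of `T_𝔭` without upper triangular representatives. -/
def divisibleHeckeSet (t : NarrowClassGroup F → (FractionalIdeal (𝓞 F)⁰ F)ˣ) (𝔫 𝔭 : Ideal (𝓞 F))
    (ν μ : NarrowClassGroup F) : Set (GL (Fin 2) F) :=
  {β | β ∈ heckeSet t 𝔫 𝔭 ν μ ∧ β.1 0 0 ∈ (𝔭 : FractionalIdeal (𝓞 F)⁰ F) ∧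
    β.1 1 0 ∈ (𝔭 : FractionalIdeal (𝓞 F)⁰ F) *
      ((𝔫 : FractionalIdeal (𝓞 F)⁰ F) * (t μ * different F))}

lemma mul_inv_mem_Gamma_of_mem_divisibleHeckeSet {β β' : GL (Fin 2) F}
    (hβ : β ∈ divisibleHeckeSet t 𝔫 𝔭 ν μ) (hβ' : β' ∈ divisibleHeckeSet t 𝔫 𝔭 ν μ) :
    β * β'⁻¹ ∈ Gamma (t μ) 𝔫 := by
  obtain ⟨⟨hdet, hspan, -, hb, -, hd⟩, ha, hc⟩ := hβ
  obtain ⟨⟨hdet', hspan', -, hb', -, hd'⟩, ha', hc'⟩ := hβ'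
  have hbc : (𝔭 : FractionalIdeal (𝓞 F)⁰ F) *
        ((𝔫 : FractionalIdeal (𝓞 F)⁰ F) * (t μ * different F)) *
        ((t ν : FractionalIdeal (𝓞 F)⁰ F) * different F)⁻¹ ≤
      (𝔭 : FractionalIdeal (𝓞 F)⁰ F) * (t μ * (t ν)⁻¹ : (FractionalIdeal (𝓞 F)⁰ F)ˣ) := by
    have hD := different_ne_zero (F := F)
    refine le_of_eq_of_le ?_ (coeIdeal_mul_le 𝔫 _)
    push_cast
    field_simp
  have hcd : (𝔭 : FractionalIdeal (𝓞 F)⁰ F) *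
        ((𝔫 : FractionalIdeal (𝓞 F)⁰ F) * (t μ * different F)) *
        (t μ * (t ν)⁻¹ : (FractionalIdeal (𝓞 F)⁰ F)ˣ) ≤
      (𝔫 : FractionalIdeal (𝓞 F)⁰ F) * (t μ * different F) *
        ((𝔭 : FractionalIdeal (𝓞 F)⁰ F) * (t μ * (t ν)⁻¹ : (FractionalIdeal (𝓞 F)⁰ F)ˣ)) := by
    rw [mul_assoc, mul_left_comm]
  rw [mul_inv_mem_Gamma_iff hdet hdet' hspan hspan', mul_left_comm ((_ * different F)⁻¹),
    inv_mul_different_mul_div, mul_comm (β.1 0 1), mul_comm (β.1 0 1), mul_comm (β.1 1 1),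
    mul_comm (β.1 1 1)]
  exact ⟨sub_mem_fractionalIdeal (FractionalIdeal.mul_mem_mul ha hd')
      (mul_mem_of_mul_le hbc hc' hb),
    sub_mem_fractionalIdeal (FractionalIdeal.mul_mem_mul ha' hb)
      (FractionalIdeal.mul_mem_mul ha hb'),
    sub_mem_fractionalIdeal (mul_mem_of_mul_le hcd hc hd') (mul_mem_of_mul_le hcd hc' hd),
    sub_mem_fractionalIdeal (FractionalIdeal.mul_mem_mul ha' hd)
      (mul_mem_of_mul_le hbc hc hb')⟩

lemma IsHeckeDet.nonempty_divisibleHeckeSet (h𝔫 : 𝔫 ≠ ⊥) (h𝔭 : 𝔭 ≠ ⊥) (h𝔭𝔫 : IsCoprime 𝔭 𝔫)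
    {δ : Fˣ} (hδ : IsHeckeDet t 𝔭 ν μ δ) : (divisibleHeckeSet t 𝔫 𝔭 ν μ).Nonempty := by
  obtain ⟨a, ha, b, hb, c, hc, d, hd, ha𝔫, hdet⟩ := exists_mul_sub_mul_eq h𝔭𝔫 h𝔭 h𝔫
    (mul_ne_zero (t μ).ne_zero different_ne_zero) (mem_of_spanSingleton_eq hδ.span_eq)
  rw [inv_mul_different_mul_div] at hb
  rw [← Matrix.det_fin_two_of] at hdet
  exact ⟨Matrix.GeneralLinearGroup.mkOfDetNeZero !![(a : F), b; c, d]
      (hdet ▸ δ.ne_zero :),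
    ⟨(hdet ▸ hδ.totPos :), (hdet ▸ hδ.span_eq :), ⟨a, rfl, ha𝔫⟩, hb, coeIdeal_mul_le 𝔭 _ hc, hd⟩,
    FractionalIdeal.mem_coeIdeal_of_mem _ ha, hc⟩

lemma IsHeckeDet.exists_mul_inv_upperTri_mem_Gamma (h𝔭 : 𝔭.IsMaximal) (h𝔭𝔫 : IsCoprime 𝔭 𝔫)
    {δ : Fˣ} (hδ : IsHeckeDet t 𝔭 ν μ δ) {β : GL (Fin 2) F} (hβ : β ∈ heckeSet t 𝔫 𝔭 ν μ)
    (hβdiv : β ∉ divisibleHeckeSet t 𝔫 𝔭 ν μ) :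
    ∃ b ∈ ((t ν : FractionalIdeal (𝓞 F)⁰ F) * different F)⁻¹,
      β * (upperTri b δ)⁻¹ ∈ Gamma (t μ) 𝔫 := by
  obtain ⟨-, hspan, ⟨a, ha, -⟩, hb, hc, hd⟩ := id hβ
  obtain ⟨x, hx, y, hy, hxy⟩ := exists_one_sub_mul_add_mul_mem h𝔭 h𝔭𝔫
    (mul_ne_zero (t μ).ne_zero different_ne_zero)
    (ha ▸ (FractionalIdeal.mem_one_iff _).mpr ⟨a, rfl⟩) hc fun h => hβdiv ⟨hβ, h⟩
  have hdet := mem_of_spanSingleton_eq hspan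
  rw [Matrix.det_fin_two] at hdet
  have hJ := inv_mul_different_mul_div (t ν) (t μ)
  refine ⟨x * β.1 0 1 + y * β.1 1 1, add_mem_fractionalIdeal
    (mul_mem_of_mul_le (one_mul _).le hx hb) (mul_mem_of_mul_le hJ.le hy hd),
    (mul_inv_upperTri_mem_Gamma_iff hβ hδ _).mpr ⟨?_, ?_⟩⟩
  · convert sub_mem_fractionalIdeal (FractionalIdeal.mul_mem_mul hxy hb)
      (mul_mem_of_mul_le ((mul_left_comm _ _ _).trans (congrArg _ hJ)).le hy hdet) using 1
    ring
  · convert add_mem_fractionalIdeal (FractionalIdeal.mul_mem_mul hxy hd)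
      (mul_mem_of_mul_le (one_mul _).le hx hdet) using 1
    ring

lemma upperTri_mul_inv_notMem_Gamma (h𝔭 : 𝔭 ≠ ⊤) (b : F) (δ : Fˣ) {β : GL (Fin 2) F}
    (hβ : β ∈ divisibleHeckeSet t 𝔫 𝔭 ν μ) : upperTri b δ * β⁻¹ ∉ Gamma (t μ) 𝔫 := fun h => by
  obtain ⟨-, -, ha, hb, -⟩ := h
  have hentry : 1 = (upperTri b δ * β⁻¹).1 0 0 * β.1 0 0 +
      (upperTri b δ * β⁻¹).1 0 1 * β.1 1 0 := by
    rw [← Fin.sum_univ_two fun j => (upperTri b δ * β⁻¹).1 0 j * β.1 j 0, ← Matrix.mul_apply,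
      ← Units.val_mul, inv_mul_cancel_right, upperTri_val]
    rfl
  have hD := different_ne_zero (F := F)
  have hbc : ((t μ : FractionalIdeal (𝓞 F)⁰ F) * different F)⁻¹ *
      ((𝔭 : FractionalIdeal (𝓞 F)⁰ F) * (𝔫 * (t μ * different F))) ≤ 𝔭 := by
    refine le_of_eq_of_le ?_ (coeIdeal_mul_le 𝔫 _)
    field_simp
  have hone : algebraMap (𝓞 F) F 1 ∈ (𝔭 : FractionalIdeal (𝓞 F)⁰ F) := by
    rw [map_one, hentry]
    exact add_mem_fractionalIdeal (mul_mem_of_mul_le (one_mul _).le ha hβ.2.1)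
      (mul_mem_of_mul_le hbc hb hβ.2.2)
  exact h𝔭 ((Ideal.eq_top_iff_one _).mpr (mem_coeIdeal_iff.mp hone))

end Cosets

section HeckeOperator

variable {F : Type*} [Field F] [NumberField F]
  {t : NarrowClassGroup F → (FractionalIdeal (𝓞 F)⁰ F)ˣ}

lemma IsRepresentatives.exists_mul_eq_spanSingleton (ht : IsRepresentatives t)
    (𝔟 : (FractionalIdeal (𝓞 F)⁰ F)ˣ) : ∃ (ν : NarrowClassGroup F) (x : Fˣ), TotPos (x : F) ∧
      (𝔟 * t ν : FractionalIdeal (𝓞 F)⁰ F) = FractionalIdeal.spanSingleton (𝓞 F)⁰ (x : F) := by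
  obtain ⟨x, hx, hx𝔟⟩ := QuotientGroup.eq.mp (ht (QuotientGroup.mk 𝔟⁻¹)).symm
  refine ⟨QuotientGroup.mk 𝔟⁻¹, x, hx, ?_⟩
  rw [← coe_toPrincipalIdeal, hx𝔟, inv_inv, Units.val_mul]

lemma IsRepresentatives.eq_of_eq_mul (ht : IsRepresentatives t) {ν μ : NarrowClassGroup F} {x : Fˣ}
    (hx : TotPos (x : F))
    (h : (t μ : FractionalIdeal (𝓞 F)⁰ F) =
      FractionalIdeal.spanSingleton (𝓞 F)⁰ (x : F) * t ν) : μ = ν := by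
  rw [← ht μ, ← ht ν, eq_comm, QuotientGroup.eq]
  refine ⟨x, hx, ?_⟩
  rw [eq_inv_mul_iff_mul_eq]
  ext1
  rw [Units.val_mul, coe_toPrincipalIdeal, h, mul_comm]

variable {𝔪 𝔫 𝔭 : Ideal (𝓞 F)} {ν μ μ' κ : NarrowClassGroup F} {δ ε : Fˣ}

lemma IsHeckeDet.eq (ht : IsRepresentatives t) (h𝔪 : 𝔪 ≠ ⊥) (hδ : IsHeckeDet t 𝔪 ν μ δ)
    (hε : IsHeckeDet t 𝔪 ν κ ε) : κ = μ := by
  refine ht.eq_of_eq_mul (x := ε * δ⁻¹) ?_ ?_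
  · rw [Units.val_mul, Units.val_inv_eq_inv_val]
    exact hε.totPos.mul hδ.totPos.inv
  · have h𝔪' : (𝔪 : FractionalIdeal (𝓞 F)⁰ F) ≠ 0 := FractionalIdeal.coeIdeal_ne_zero.mpr h𝔪
    have hν := (t ν).ne_zero
    have hμ := (t μ).ne_zero
    rw [Units.val_mul, Units.val_inv_eq_inv_val, ← FractionalIdeal.spanSingleton_mul_spanSingleton,
      ← FractionalIdeal.spanSingleton_inv, hδ.span_eq, hε.span_eq]
    push_cast
    field_simp

lemma IsHeckeDet.heckeSet_eq_empty (ht : IsRepresentatives t) (h𝔪 : 𝔪 ≠ ⊥)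
    (hδ : IsHeckeDet t 𝔪 ν μ δ) (hκ : κ ≠ μ) : heckeSet t 𝔫 𝔪 ν κ = ∅ :=
  Set.eq_empty_of_forall_notMem fun _ hβ => hκ (hδ.eq ht h𝔪 (isHeckeDet_of_mem_heckeSet hβ))

lemma mul_inv_upperTri_mem_centralSet (h𝔭 : 𝔭 ≠ ⊥) (hε : TotPos (ε : F))
    (hεspan : (𝔭 : FractionalIdeal (𝓞 F)⁰ F) * FractionalIdeal.spanSingleton (𝓞 F)⁰ (ε : F) =
      (t μ' * (t ν)⁻¹ : (FractionalIdeal (𝓞 F)⁰ F)ˣ)) {β : GL (Fin 2) F}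
    (hβ : β ∈ divisibleHeckeSet t 𝔫 𝔭 ν μ) :
    β * (upperTri 0 ε)⁻¹ ∈
      centralSet t 𝔫 (Units.mk0 _ (FractionalIdeal.coeIdeal_ne_zero.mpr h𝔭)) μ' μ := by
  obtain ⟨⟨hdet, hspan, -, hb, -, hd⟩, ha, hc⟩ := hβ
  have h𝔭' : (𝔭 : FractionalIdeal (𝓞 F)⁰ F) ≠ 0 := FractionalIdeal.coeIdeal_ne_zero.mpr h𝔭
  have hD := different_ne_zero (F := F)
  have hν := (t ν).ne_zero
  have hμ := (t μ).ne_zero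
  have hμ' := (t μ').ne_zero
  have hε' := (eq_inv_mul_iff_mul_eq₀ h𝔭').mpr hεspan
  have hmem (x : F) (J : FractionalIdeal (𝓞 F)⁰ F) :=
    mul_inv_mem_iff_of_spanSingleton_eq (y := x) (B := J) ε.ne_zero hε'
  refine ⟨?_, ?_, ?_, ?_, ?_, ?_⟩
  · rw [det_mul_inv, det_upperTri]
    exact hdet.mul hε.inv
  · rw [det_mul_inv, det_upperTri, ← FractionalIdeal.spanSingleton_mul_spanSingleton,
      ← FractionalIdeal.spanSingleton_inv, hε', hspan]
    simp only [Units.val_mul, Units.val_inv_eq_inv_val, Units.val_mk0]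
    field_simp
  all_goals
    simp only [mul_inv_val_fin_two, upperTri_val, Matrix.det_fin_two_of, Matrix.of_apply,
      Matrix.cons_val', Matrix.cons_val_zero, Matrix.cons_val_one, Matrix.cons_val_fin_one,
      mul_zero, sub_zero, mul_one, one_mul, mul_inv_cancel_right₀ ε.ne_zero, Units.val_mk0, hmem]
  · exact ha
  · convert hb using 1
    push_cast
    field_simp
  · exact hc
  · convert hd using 1
    simp only [Units.val_mul, Units.val_inv_eq_inv_val, Units.val_mk0]
    field_simp

variable {k : (F →+* ℝ) → ℕ} {f : Family F}

lemma HasTrivialCharacter.slash_eq_of_mem_divisibleHeckeSet (hf : HasTrivialCharacter t k 𝔫 f)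
    (h𝔭 : 𝔭 ≠ ⊥) (hε : TotPos (ε : F))
    (hεspan : (𝔭 : FractionalIdeal (𝓞 F)⁰ F) * FractionalIdeal.spanSingleton (𝓞 F)⁰ (ε : F) =
      (t μ' * (t ν)⁻¹ : (FractionalIdeal (𝓞 F)⁰ F)ˣ)) {β : GL (Fin 2) F}
    (hβ : β ∈ divisibleHeckeSet t 𝔫 𝔭 ν μ) :
    slash k (f μ) β = slash k (f μ') (upperTri 0 ε) := by
  have hmem := mul_inv_upperTri_mem_centralSet h𝔭 hε hεspan hβ
  rw [← inv_mul_cancel_right β (upperTri 0 ε), slash_mul k _ hmem.1 (by rwa [det_upperTri]),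
    hf _ _ _ _ hmem]

lemma mk_rightRel_eq_iff {G : Type*} [Group G] {H : Subgroup G} {x y : G} :
    Quotient.mk (QuotientGroup.rightRel H) x = Quotient.mk (QuotientGroup.rightRel H) y ↔
      y * x⁻¹ ∈ H :=
  Quotient.eq.trans QuotientGroup.rightRel_apply

lemma IsModularForm.slash_out_mk {T : (FractionalIdeal (𝓞 F)⁰ F)ˣ} {g : HalfSpace F → ℂ}
    (hg : IsModularForm k (Gamma T 𝔫) g) {β : GL (Fin 2) F} (hβ : TotPos β.1.det) :
    slash k g (Quotient.out (Quotient.mk (QuotientGroup.rightRel (Gamma T 𝔫)) β)) =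
      slash k g β :=
  slash_eq_of_mul_inv_mem k hg.slash_eq (fun _ hγ => hγ.1) hβ
    (mk_rightRel_eq_iff.mp (Quotient.out_eq _).symm)

lemma IsHeckeDet.image_mk_heckeSet (h𝔭 : 𝔭.IsMaximal) (h𝔭𝔫 : IsCoprime 𝔭 𝔫)
    (hδ : IsHeckeDet t 𝔭 ν μ δ) {β₀ : GL (Fin 2) F} (hβ₀ : β₀ ∈ divisibleHeckeSet t 𝔫 𝔭 ν μ)
    {B : 𝓞 F ⧸ 𝔭 → F} (hB : ∀ x, B x ∈ ((t ν : FractionalIdeal (𝓞 F)⁰ F) * different F)⁻¹)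
    (hB' : ∀ b ∈ ((t ν : FractionalIdeal (𝓞 F)⁰ F) * different F)⁻¹, ∃ x, b - B x ∈
      (𝔭 : FractionalIdeal (𝓞 F)⁰ F) * ((t ν : FractionalIdeal (𝓞 F)⁰ F) * different F)⁻¹) :
    Quotient.mk (QuotientGroup.rightRel (Gamma (t μ) 𝔫)) '' heckeSet t 𝔫 𝔭 ν μ =
      insert (Quotient.mk _ β₀) (Set.range fun x => Quotient.mk _ (upperTri (B x) δ)) := by
  ext q
  constructor
  · rintro ⟨β, hβ, rfl⟩
    by_cases hdiv : β ∈ divisibleHeckeSet t 𝔫 𝔭 ν μ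
    · exact Or.inl (mk_rightRel_eq_iff.mpr (mul_inv_mem_Gamma_of_mem_divisibleHeckeSet hβ₀ hdiv))
    · obtain ⟨b, hb, hβb⟩ := hδ.exists_mul_inv_upperTri_mem_Gamma h𝔭 h𝔭𝔫 hβ hdiv
      obtain ⟨x, hx⟩ := hB' b hb
      have hbx := (hδ.upperTri_mul_inv_mem_Gamma_iff (𝔫 := 𝔫) hb).mpr hx
      exact Or.inr ⟨x, (mk_rightRel_eq_iff.mpr hbx).trans (mk_rightRel_eq_iff.mpr hβb)⟩
  · rintro (rfl | ⟨x, rfl⟩)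
    · exact Set.mem_image_of_mem _ hβ₀.1
    · exact Set.mem_image_of_mem _ (hδ.upperTri_mem_heckeSet (hB x))

lemma IsHeckeDet.exists_finsum_slash_eq (h𝔭 : 𝔭.IsMaximal) (h𝔭0 : 𝔭 ≠ ⊥)
    (h𝔭𝔫 : IsCoprime 𝔭 𝔫) (hδ : IsHeckeDet t 𝔭 ν μ δ) {g : HalfSpace F → ℂ}
    (hg : IsModularForm k (Gamma (t μ) 𝔫) g) :
    ∃ β₀ ∈ divisibleHeckeSet t 𝔫 𝔭 ν μ, ∃ B : 𝓞 F ⧸ 𝔭 → F,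
      (∀ x, B x ∈ ((t ν : FractionalIdeal (𝓞 F)⁰ F) * different F)⁻¹) ∧ ∀ τ,
        ∑ᶠ q ∈ Quotient.mk (QuotientGroup.rightRel (Gamma (t μ) 𝔫)) '' heckeSet t 𝔫 𝔭 ν μ,
            slash k g (Quotient.out q) τ =
          slash k g β₀ τ + ∑ᶠ x, slash k g (upperTri (B x) δ) τ := by
  have : Finite (𝓞 F ⧸ 𝔭) := Ideal.finiteQuotientOfFreeOfNeBot 𝔭 h𝔭0
  have h𝔫 : 𝔫 ≠ ⊥ := by
    rintro rfl
    exact h𝔭.ne_top (by simpa using h𝔭𝔫.sup_eq)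
  obtain ⟨β₀, hβ₀⟩ := hδ.nonempty_divisibleHeckeSet h𝔫 h𝔭0 h𝔭𝔫
  obtain ⟨B, hB, hB'⟩ := exists_residue_system h𝔭
    (inv_ne_zero (mul_ne_zero (t ν).ne_zero (different_ne_zero (F := F))))
  refine ⟨β₀, hβ₀, B, hB, fun τ => ?_⟩
  have hinj : Function.Injective fun x =>
      Quotient.mk (QuotientGroup.rightRel (Gamma (t μ) 𝔫)) (upperTri (B x) δ) := fun x y hxy =>
    (hB' _ (hB y)).unique
      ((hδ.upperTri_mul_inv_mem_Gamma_iff (hB y)).mp (mk_rightRel_eq_iff.mp hxy))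
      (by simpa using FractionalIdeal.zero_mem _)
  have hnotMem : Quotient.mk (QuotientGroup.rightRel (Gamma (t μ) 𝔫)) β₀ ∉
      Set.range fun x => Quotient.mk _ (upperTri (B x) δ) := fun ⟨x, hx⟩ =>
    upperTri_mul_inv_notMem_Gamma h𝔭.ne_top (B x) δ hβ₀ (mk_rightRel_eq_iff.mp hx.symm)
  rw [hδ.image_mk_heckeSet h𝔭 h𝔭𝔫 hβ₀ hB fun b hb => (hB' b hb).exists,
    finsum_mem_insert _ hnotMem (Set.finite_range _), finsum_mem_range hinj,
    hg.slash_out_mk hβ₀.1.1]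
  exact congrArg _ (finsum_congr fun x => by
    rw [hg.slash_out_mk (det_upperTri (B x) δ ▸ hδ.totPos)])

lemma IsHeckeDet.exists_hecke_eq (ht : IsRepresentatives t) (h𝔭 : 𝔭.IsMaximal)
    (h𝔭0 : 𝔭 ≠ ⊥) (h𝔭𝔫 : IsCoprime 𝔭 𝔫) (hf : ∀ ν, IsModularForm k (Gamma (t ν) 𝔫) (f ν))
    (hχ : HasTrivialCharacter t k 𝔫 f) (hδ : IsHeckeDet t 𝔭 ν μ δ) (hε : TotPos (ε : F))
    (hεspan : (𝔭 : FractionalIdeal (𝓞 F)⁰ F) * FractionalIdeal.spanSingleton (𝓞 F)⁰ (ε : F) =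
      (t μ' * (t ν)⁻¹ : (FractionalIdeal (𝓞 F)⁰ F)ˣ)) :
    ∃ B : 𝓞 F ⧸ 𝔭 → F, (∀ x, B x ∈ ((t ν : FractionalIdeal (𝓞 F)⁰ F) * different F)⁻¹) ∧
      ∀ τ, hecke t k 𝔫 𝔭 f ν τ =
        (((Ideal.absNorm 𝔭 : ℝ) ^ ((maxWeight k : ℝ) / 2 - 1) : ℝ) : ℂ) *
          (slash k (f μ') (upperTri 0 ε) τ + ∑ᶠ x, slash k (f μ) (upperTri (B x) δ) τ) := by
  obtain ⟨β₀, hβ₀, B, hB, hsum⟩ := hδ.exists_finsum_slash_eq h𝔭 h𝔭0 h𝔭𝔫 (hf μ)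
  refine ⟨B, hB, fun τ => ?_⟩
  rw [hecke, finsum_eq_single _ μ fun κ hκ => by
      rw [hδ.heckeSet_eq_empty ht h𝔭0 hκ, Set.image_empty, finsum_mem_empty],
    hsum, hχ.slash_eq_of_mem_divisibleHeckeSet h𝔭0 hε hεspan hβ₀]

end HeckeOperator

section Coefficients

variable {F : Type*} [Field F] [NumberField F] {k : (F →+* ℝ) → ℕ}
  {f : Family F} {ν ν' μ μ' : NarrowClassGroup F}

/-- The weighted Fourier coefficient `a_ν(ξ) ξ^{-k/2}`. It depends only on the ideal `ξt_ν⁻¹`. -/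
def weightedCoeff (k : (F →+* ℝ) → ℕ) (f : Family F) (ν : NarrowClassGroup F) (ξ : F) : ℂ :=
  fourierCoeff (f ν) ξ * weightFactor k ξ

lemma absNorm_cast_pos {𝔪 : Ideal (𝓞 F)} (h𝔪 : 𝔪 ≠ ⊥) : (0 : ℝ) < Ideal.absNorm 𝔪 :=
  Nat.cast_pos.mpr (Nat.pos_of_ne_zero (Ideal.absNorm_eq_zero_iff.not.mpr h𝔪))

/-- `f` is a Hilbert modular form of weight `k` and level `𝔫` with trivial character, and an
eigenfunction of `T_𝔭` with eigenvalue `c`. -/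
structure IsHeckeEigenform (t : NarrowClassGroup F → (FractionalIdeal (𝓞 F)⁰ F)ˣ)
    (k : (F →+* ℝ) → ℕ) (𝔫 𝔭 : Ideal (𝓞 F)) (f : Family F) (c : ℂ) : Prop where
  isModularForm : ∀ ν, IsModularForm k (Gamma (t ν) 𝔫) (f ν)
  trivial_character : HasTrivialCharacter t k 𝔫 f
  hecke_eq : hecke t k 𝔫 𝔭 f = c • f

variable [IsTotallyReal F] {t : NarrowClassGroup F → (FractionalIdeal (𝓞 F)⁰ F)ˣ}
  {𝔪 𝔫 𝔭 : Ideal (𝓞 F)} {δ ε ξ ξ' : Fˣ}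

lemma weightedCoeff_eq_zero (hf : IsModularForm k (Gamma (t ν) 𝔫) (f ν)) {x : F}
    (hx : x ∉ (t ν : FractionalIdeal (𝓞 F)⁰ F)) : weightedCoeff k f ν x = 0 := by
  rw [weightedCoeff, by_contra fun h => hx (hf.mem_of_fourierCoeff_ne_zero h), zero_mul]

lemma weightedCoeff_eq_of_mul_eq (ht : IsRepresentatives t)
    (hf : ∀ ν, IsModularForm k (Gamma (t ν) 𝔫) (f ν)) (hξ : TotPos (ξ : F))
    (hξ' : TotPos (ξ' : F))
    (h : (𝔪 * t ν : FractionalIdeal (𝓞 F)⁰ F) = FractionalIdeal.spanSingleton (𝓞 F)⁰ (ξ : F))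
    (h' : (𝔪 * t ν' : FractionalIdeal (𝓞 F)⁰ F) = FractionalIdeal.spanSingleton (𝓞 F)⁰ (ξ' : F)) :
    weightedCoeff k f ν' ξ' = weightedCoeff k f ν ξ := by
  have hspan : FractionalIdeal.spanSingleton (𝓞 F)⁰ (ξ : F) ≠ 0 :=
    FractionalIdeal.spanSingleton_ne_zero_iff.mpr ξ.ne_zero
  have h𝔪 : (𝔪 : FractionalIdeal (𝓞 F)⁰ F) ≠ 0 := left_ne_zero_of_mul (h ▸ hspan)
  have hpos : TotPos ((ξ' * ξ⁻¹ : Fˣ) : F) := by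
    rw [Units.val_mul, Units.val_inv_eq_inv_val]
    exact hξ'.mul hξ.inv
  have hquot : FractionalIdeal.spanSingleton (𝓞 F)⁰ ((ξ' * ξ⁻¹ : Fˣ) : F) =
      t ν' * (t ν : FractionalIdeal (𝓞 F)⁰ F)⁻¹ := by
    have hν := (t ν).ne_zero
    rw [Units.val_mul, Units.val_inv_eq_inv_val, ← FractionalIdeal.spanSingleton_mul_spanSingleton,
      ← FractionalIdeal.spanSingleton_inv, ← h, ← h']
    field_simp
  obtain rfl : ν' = ν := ht.eq_of_eq_mul hpos (by
    rw [hquot, inv_mul_cancel_right₀ (t ν).ne_zero])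
  rw [mul_inv_cancel₀ (t ν').ne_zero] at hquot
  have hcoeff := (hf ν').fourierCoeff_mul_weightFactor_of_unit hpos hquot hξ
  rwa [← Units.val_mul, inv_mul_cancel_right] at hcoeff

lemma coeffC_eq_weightedCoeff_mul (ht : IsRepresentatives t)
    (hf : ∀ ν, IsModularForm k (Gamma (t ν) 𝔫) (f ν)) (hξ : TotPos (ξ : F))
    (h : (𝔪 * t ν : FractionalIdeal (𝓞 F)⁰ F) = FractionalIdeal.spanSingleton (𝓞 F)⁰ (ξ : F)) :
    coeffC t k f 𝔪 = weightedCoeff k f ν ξ *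
      (((Ideal.absNorm 𝔪 : ℝ) ^ ((maxWeight k : ℝ) / 2) : ℝ) : ℂ) := by
  have hex : ∃ x : NarrowClassGroup F × F, TotPos x.2 ∧ (𝔪 : FractionalIdeal (𝓞 F)⁰ F) =
      FractionalIdeal.spanSingleton (𝓞 F)⁰ x.2 * ((t x.1)⁻¹ : (FractionalIdeal (𝓞 F)⁰ F)ˣ) :=
    ⟨(ν, ξ), hξ, by rw [← h, mul_assoc, Units.mul_inv, mul_one]⟩
  have hmul : (𝔪 * t hex.choose.1 : FractionalIdeal (𝓞 F)⁰ F) =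
      FractionalIdeal.spanSingleton (𝓞 F)⁰ hex.choose.2 := by
    refine (congrArg (· * (t hex.choose.1 : FractionalIdeal (𝓞 F)⁰ F)) hex.choose_spec.2).trans ?_
    rw [mul_assoc, Units.inv_mul, mul_one]
  obtain ⟨σ⟩ := nonempty_realEmbedding (F := F)
  have hne : hex.choose.2 ≠ 0 := fun h0 =>
    (hex.choose_spec.1 σ).ne' (by rw [h0, map_zero])
  rw [coeffC, dif_pos hex]
  exact congrArg (· * _) (weightedCoeff_eq_of_mul_eq (ξ' := Units.mk0 _ hne) ht hf hξ
    hex.choose_spec.1 h hmul)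

lemma normCoeff_eq_weightedCoeff_mul (ht : IsRepresentatives t)
    (hf : ∀ ν, IsModularForm k (Gamma (t ν) 𝔫) (f ν)) (hξ : TotPos (ξ : F))
    (h : (𝔪 * t ν : FractionalIdeal (𝓞 F)⁰ F) = FractionalIdeal.spanSingleton (𝓞 F)⁰ (ξ : F)) :
    normCoeff t k f 𝔪 =
      weightedCoeff k f ν ξ * (((Ideal.absNorm 𝔪 : ℝ) ^ (1 / 2 : ℝ) : ℝ) : ℂ) := by
  have h𝔪 : (𝔪 : FractionalIdeal (𝓞 F)⁰ F) ≠ 0 :=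
    left_ne_zero_of_mul (h ▸ FractionalIdeal.spanSingleton_ne_zero_iff.mpr ξ.ne_zero)
  have hN := absNorm_cast_pos (FractionalIdeal.coeIdeal_ne_zero.mp h𝔪)
  rw [normCoeff, coeffC_eq_weightedCoeff_mul ht hf hξ h, mul_div_assoc, ← Complex.ofReal_div,
    ← Real.rpow_sub hN]
  ring_nf

lemma IsHeckeEigenform.eigenvalue_mul_weightedCoeff {c : ℂ} (hf : IsHeckeEigenform t k 𝔫 𝔭 f c)
    (ht : IsRepresentatives t) (h𝔭 : 𝔭.IsMaximal) (h𝔭0 : 𝔭 ≠ ⊥)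
    (h𝔭𝔫 : IsCoprime 𝔭 𝔫) (hδ : IsHeckeDet t 𝔭 ν μ δ) (hε : TotPos (ε : F))
    (hεspan : (𝔭 : FractionalIdeal (𝓞 F)⁰ F) * FractionalIdeal.spanSingleton (𝓞 F)⁰ (ε : F) =
      (t μ' * (t ν)⁻¹ : (FractionalIdeal (𝓞 F)⁰ F)ˣ)) {x : F} (hx : TotPos x)
    (hxν : x ∈ (t ν : FractionalIdeal (𝓞 F)⁰ F)) :
    c * weightedCoeff k f ν x =
      (((Ideal.absNorm 𝔭 : ℝ) ^ ((maxWeight k : ℝ) / 2 - 1) : ℝ) : ℂ) *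
        (weightedCoeff k f μ' (ε * x) + Ideal.absNorm 𝔭 * weightedCoeff k f μ (δ * x)) := by
  have : Fintype (𝓞 F ⧸ 𝔭) :=
    have := Ideal.finiteQuotientOfFreeOfNeBot 𝔭 h𝔭0
    Fintype.ofFinite _
  obtain ⟨B, hB, hheckeB⟩ := hδ.exists_hecke_eq ht h𝔭 h𝔭0 h𝔭𝔫 hf.isModularForm
    hf.trivial_character hε hεspan
  have hexp (κ : NarrowClassGroup F) := (hf.isModularForm κ).hasSum_fourierCoeff
  have hright (τ : HalfSpace F) := (((hasSum_slash_upperTri k (hexp μ') 0 hε τ).add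
    (hasSum_sum (s := Finset.univ) fun x _ =>
      hasSum_slash_upperTri k (hexp μ) (B x) hδ.totPos τ)).mul_left
    (((Ideal.absNorm 𝔭 : ℝ) ^ ((maxWeight k : ℝ) / 2 - 1) : ℝ) : ℂ))
  have hleft (τ : HalfSpace F) := (hexp ν τ).mul_left c
  simp_rw [← finsum_eq_sum_of_fintype, ← hheckeB, finsum_eq_sum_of_fintype, hf.hecke_eq,
    Pi.smul_apply, smul_eq_mul, ← Finset.sum_mul, ← add_mul, ← mul_assoc] at hright
  simp_rw [← mul_assoc] at hleft
  have hcoeff := congrFun (eq_of_hasSum_expTrace hleft hright) x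
  have htrace (y : 𝓞 F ⧸ 𝔭) : traceChar (x * B y) = 1 :=
    (mem_iff_traceChar_mul_eq_one (t ν).ne_zero).mp hxν _ (hB y)
  have hcard : (Fintype.card (𝓞 F ⧸ 𝔭) : ℂ) = Ideal.absNorm 𝔭 := by
    rw [Ideal.absNorm_apply, Submodule.cardQuot_apply, Nat.card_eq_fintype_card]
  simp only [mul_zero, traceChar_zero, mul_one, htrace, Finset.sum_const, Finset.card_univ,
    nsmul_eq_mul, hcard] at hcoeff
  rw [weightedCoeff, ← mul_assoc, hcoeff, weightedCoeff, weightedCoeff, weightFactor_mul k hε hx,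
    weightFactor_mul k hδ.totPos hx]
  ring

end Coefficients

section Chebyshev

open Polynomial

lemma eq_eval_chebyshev_S_of_recursion {R : Type*} [CommRing R] {c : ℕ → R} {x : R}
    (h0 : c 0 = 1) (h1 : c 1 = x) (h : ∀ n, c (n + 2) = x * c (n + 1) - c n) (n : ℕ) :
    c n = (Chebyshev.S R n).eval x := by
  induction n using Nat.twoStepInduction with
  | zero => simp [h0]
  | one => simp [h1]
  | more n ih₀ ih₁ => simp_all [Chebyshev.S_add_two]

lemma abs_sin_le_norm_eval_chebyshev_S (θ : ℝ) (n : ℕ) :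
    |Real.sin ((n + 1) * θ)| ≤ ‖(Chebyshev.S ℂ n).eval ((2 * Real.cos θ : ℝ) : ℂ)‖ := by
  have hS : ((2 * Real.cos θ : ℝ) : ℂ) = 2 * Complex.cos θ := by push_cast; rfl
  have hsin : Complex.sin (((n : ℤ) + 1) * θ) = (Real.sin ((n + 1) * θ) : ℂ) := by
    push_cast
    rfl
  rw [← Real.norm_eq_abs, ← Complex.norm_real, ← hsin, ← Chebyshev.S_two_mul_complex_cos, hS,
    norm_mul, ← Complex.ofReal_sin, Complex.norm_real]
  exact mul_le_of_le_one_right (norm_nonneg _) (Real.abs_sin_le_one θ)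

end Chebyshev

lemma normCoeff_top {F : Type*} [Field F] [NumberField F]
    {t : NarrowClassGroup F → (FractionalIdeal (𝓞 F)⁰ F)ˣ} {k : (F →+* ℝ) → ℕ} {f : Family F}
    (hone : coeffC t k f ⊤ = 1) : normCoeff t k f ⊤ = 1 := by
  simp [normCoeff, hone]

lemma IsPrimitive.exists_isHeckeEigenform {F : Type*} [Field F] [NumberField F]
    {t : NarrowClassGroup F → (FractionalIdeal (𝓞 F)⁰ F)ˣ} {k : (F →+* ℝ) → ℕ}
    {𝔫 𝔭 : Ideal (𝓞 F)} {f : Family F} (hf : IsPrimitive t k 𝔫 f) (h𝔭 : 𝔭 ≠ ⊥) :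
    ∃ c, IsHeckeEigenform t k 𝔫 𝔭 f c :=
  (hf.eigen 𝔭 h𝔭).imp fun _ hc =>
    ⟨fun ν => (hf.new.1 ν).toIsModularForm, hf.trivial_character, hc⟩

section HeckeRelations

variable {F : Type*} [Field F] [NumberField F] [IsTotallyReal F]
  {t : NarrowClassGroup F → (FractionalIdeal (𝓞 F)⁰ F)ˣ} {k : (F →+* ℝ) → ℕ}
  {𝔞 𝔪 𝔫 𝔭 : Ideal (𝓞 F)} {f : Family F} {c : ℂ}

lemma IsHeckeEigenform.eigenvalue_mul_normCoeff_eq (hf : IsHeckeEigenform t k 𝔫 𝔭 f c)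
    (ht : IsRepresentatives t) (h𝔭 : 𝔭.IsMaximal) (h𝔭0 : 𝔭 ≠ ⊥)
    (h𝔭𝔫 : IsCoprime 𝔭 𝔫) {ν μ μ' : NarrowClassGroup F} {δ ε ζ : Fˣ}
    (hζ : TotPos (ζ : F))
    (hζspan : (𝔪 * t ν : FractionalIdeal (𝓞 F)⁰ F) =
      FractionalIdeal.spanSingleton (𝓞 F)⁰ (ζ : F))
    (hδ : IsHeckeDet t 𝔭 ν μ δ) (hε : TotPos (ε : F))
    (hεspan : (𝔭 : FractionalIdeal (𝓞 F)⁰ F) * FractionalIdeal.spanSingleton (𝓞 F)⁰ (ε : F) =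
      (t μ' * (t ν)⁻¹ : (FractionalIdeal (𝓞 F)⁰ F)ˣ)) :
    c * normCoeff t k f 𝔪 =
      (((Ideal.absNorm 𝔭 : ℝ) ^ (((maxWeight k : ℝ) - 1) / 2) : ℝ) : ℂ) *
        (normCoeff t k f (𝔭 * 𝔪) + weightedCoeff k f μ' (ε * ζ) *
          (((Ideal.absNorm 𝔪 / Ideal.absNorm 𝔭 : ℝ) ^ (1 / 2 : ℝ) : ℝ) : ℂ)) := by
  have hζν : (ζ : F) ∈ (t ν : FractionalIdeal (𝓞 F)⁰ F) :=
    coeIdeal_mul_le 𝔪 _ (mem_of_spanSingleton_eq hζspan.symm)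
  have hδζspan : ((𝔭 * 𝔪 : Ideal (𝓞 F)) * t μ : FractionalIdeal (𝓞 F)⁰ F) =
      FractionalIdeal.spanSingleton (𝓞 F)⁰ ((δ * ζ : Fˣ) : F) := by
    have hν := (t ν).ne_zero
    rw [Units.val_mul, ← FractionalIdeal.spanSingleton_mul_spanSingleton, hδ.span_eq, ← hζspan,
      Units.val_mul, Units.val_inv_eq_inv_val, FractionalIdeal.coeIdeal_mul]
    field_simp
  have hN := absNorm_cast_pos h𝔭0
  have hexp : (Ideal.absNorm 𝔭 : ℝ) ^ (((maxWeight k : ℝ) - 1) / 2) =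
      (Ideal.absNorm 𝔭 : ℝ) ^ ((maxWeight k : ℝ) / 2 - 1) * √(Ideal.absNorm 𝔭) := by
    rw [Real.sqrt_eq_rpow, ← Real.rpow_add hN]
    ring_nf
  have hsq : ((√(Ideal.absNorm 𝔭) : ℝ) : ℂ) * (√(Ideal.absNorm 𝔭) : ℝ) = Ideal.absNorm 𝔭 := by
    rw [← Complex.ofReal_mul, Real.mul_self_sqrt hN.le, Complex.ofReal_natCast]
  have hne : ((√(Ideal.absNorm 𝔭) : ℝ) : ℂ) ≠ 0 :=
    Complex.ofReal_ne_zero.mpr (Real.sqrt_pos.mpr hN).ne'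
  rw [normCoeff_eq_weightedCoeff_mul ht hf.isModularForm hζ hζspan,
    normCoeff_eq_weightedCoeff_mul ht hf.isModularForm (hδ.totPos.mul hζ) hδζspan, ← mul_assoc,
    hf.eigenvalue_mul_weightedCoeff ht h𝔭 h𝔭0 h𝔭𝔫 hδ hε hεspan hζ hζν, hexp,
    map_mul, Nat.cast_mul, ← hsq]
  simp only [← Real.sqrt_eq_rpow, Real.sqrt_mul hN.le, Real.sqrt_div' _ hN.le]
  push_cast
  field_simp
  ring

lemma IsHeckeEigenform.exists_eigenvalue_mul_normCoeff_eq (hf : IsHeckeEigenform t k 𝔫 𝔭 f c)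
    (ht : IsRepresentatives t) (h𝔭 : 𝔭.IsMaximal) (h𝔭0 : 𝔭 ≠ ⊥)
    (h𝔭𝔫 : IsCoprime 𝔭 𝔫) (h𝔪 : 𝔪 ≠ ⊥) :
    ∃ (μ : NarrowClassGroup F) (ξ : Fˣ), TotPos (ξ : F) ∧
      (𝔪 * t μ : FractionalIdeal (𝓞 F)⁰ F) =
        𝔭 * FractionalIdeal.spanSingleton (𝓞 F)⁰ (ξ : F) ∧
      c * normCoeff t k f 𝔪 =
        (((Ideal.absNorm 𝔭 : ℝ) ^ (((maxWeight k : ℝ) - 1) / 2) : ℝ) : ℂ) *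
          (normCoeff t k f (𝔭 * 𝔪) + weightedCoeff k f μ ξ *
            (((Ideal.absNorm 𝔪 / Ideal.absNorm 𝔭 : ℝ) ^ (1 / 2 : ℝ) : ℝ) : ℂ)) := by
  have h𝔭F : (𝔭 : FractionalIdeal (𝓞 F)⁰ F) ≠ 0 := FractionalIdeal.coeIdeal_ne_zero.mpr h𝔭0
  obtain ⟨ν, ζ, hζ, hζspan⟩ := ht.exists_mul_eq_spanSingleton
    (Units.mk0 (𝔪 : FractionalIdeal (𝓞 F)⁰ F) (FractionalIdeal.coeIdeal_ne_zero.mpr h𝔪))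
  obtain ⟨κ, δ, hδ, hδspan⟩ := ht.exists_mul_eq_spanSingleton (Units.mk0 _ h𝔭F * (t ν)⁻¹)
  obtain ⟨μ, ε, hε, hεspan⟩ := ht.exists_mul_eq_spanSingleton (Units.mk0 _ h𝔭F * t ν)⁻¹
  have hδdet : IsHeckeDet t 𝔭 ν κ δ := ⟨hδ, by
    rw [← hδspan, Units.val_mul, Units.val_mul, Units.val_mk0, mul_right_comm, mul_assoc]⟩
  have hν := (t ν).ne_zero
  simp only [Units.val_mul, Units.val_inv_eq_inv_val, Units.val_mk0] at hζspan hεspan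
  have h𝔭ε : (𝔭 * FractionalIdeal.spanSingleton (𝓞 F)⁰ (ε : F) : FractionalIdeal (𝓞 F)⁰ F) =
      (t μ * (t ν)⁻¹ : (FractionalIdeal (𝓞 F)⁰ F)ˣ) := by
    rw [← hεspan, Units.val_mul, Units.val_inv_eq_inv_val]
    field_simp
  refine ⟨μ, ε * ζ, hε.mul hζ, ?_,
    hf.eigenvalue_mul_normCoeff_eq ht h𝔭 h𝔭0 h𝔭𝔫 hζ hζspan hδdet hε h𝔭ε⟩
  rw [Units.val_mul, ← FractionalIdeal.spanSingleton_mul_spanSingleton, ← hεspan, ← hζspan]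
  field_simp

lemma IsHeckeEigenform.eigenvalue_mul_normCoeff_eq_of_not_dvd (hf : IsHeckeEigenform t k 𝔫 𝔭 f c)
    (ht : IsRepresentatives t) (h𝔭 : 𝔭.IsMaximal) (h𝔭0 : 𝔭 ≠ ⊥)
    (h𝔭𝔫 : IsCoprime 𝔭 𝔫) (h𝔭𝔪 : ¬ 𝔭 ∣ 𝔪) :
    c * normCoeff t k f 𝔪 =
      (((Ideal.absNorm 𝔭 : ℝ) ^ (((maxWeight k : ℝ) - 1) / 2) : ℝ) : ℂ) *
        normCoeff t k f (𝔭 * 𝔪) := by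
  have h𝔪 : 𝔪 ≠ ⊥ := fun h => h𝔭𝔪 (h ▸ dvd_zero 𝔭)
  obtain ⟨μ, ξ, _, hspan, heq⟩ :=
    hf.exists_eigenvalue_mul_normCoeff_eq ht h𝔭 h𝔭0 h𝔭𝔫 h𝔪
  have hξ : (ξ : F) ∉ (t μ : FractionalIdeal (𝓞 F)⁰ F) := by
    refine fun h => h𝔭𝔪 (Ideal.dvd_iff_le.mpr ?_)
    have hle : (𝔪 * t μ : FractionalIdeal (𝓞 F)⁰ F) ≤ 𝔭 * t μ :=
      hspan.trans_le (mul_le_mul_right (FractionalIdeal.spanSingleton_le_iff_mem.mpr h) _)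
    have hinv := mul_le_mul_left hle (t μ : FractionalIdeal (𝓞 F)⁰ F)⁻¹
    rwa [mul_inv_cancel_right₀ (t μ).ne_zero, mul_inv_cancel_right₀ (t μ).ne_zero,
      FractionalIdeal.coeIdeal_le_coeIdeal] at hinv
  rw [heq, weightedCoeff_eq_zero (hf.isModularForm μ) hξ, zero_mul, add_zero]

lemma IsHeckeEigenform.eigenvalue_mul_normCoeff_mul_eq (hf : IsHeckeEigenform t k 𝔫 𝔭 f c)
    (ht : IsRepresentatives t) (h𝔭 : 𝔭.IsMaximal) (h𝔭0 : 𝔭 ≠ ⊥)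
    (h𝔭𝔫 : IsCoprime 𝔭 𝔫) (h𝔞 : 𝔞 ≠ ⊥) :
    c * normCoeff t k f (𝔭 * 𝔞) =
      (((Ideal.absNorm 𝔭 : ℝ) ^ (((maxWeight k : ℝ) - 1) / 2) : ℝ) : ℂ) *
        (normCoeff t k f (𝔭 * (𝔭 * 𝔞)) + normCoeff t k f 𝔞) := by
  obtain ⟨μ, ξ, hξ, hspan, heq⟩ := hf.exists_eigenvalue_mul_normCoeff_eq ht h𝔭 h𝔭0 h𝔭𝔫
    (mul_ne_zero h𝔭0 h𝔞)
  rw [FractionalIdeal.coeIdeal_mul, mul_assoc] at hspan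
  have h𝔞span := mul_left_cancel₀ (FractionalIdeal.coeIdeal_ne_zero.mpr h𝔭0) hspan
  rw [heq, normCoeff_eq_weightedCoeff_mul ht hf.isModularForm hξ h𝔞span, map_mul, Nat.cast_mul,
    mul_div_cancel_left₀ _ (absNorm_cast_pos h𝔭0).ne']

lemma IsHeckeEigenform.normCoeff_mul_normCoeff_pow (hf : IsHeckeEigenform t k 𝔫 𝔭 f c)
    (ht : IsRepresentatives t) (h𝔭 : 𝔭.IsMaximal) (h𝔭0 : 𝔭 ≠ ⊥)
    (h𝔭𝔫 : IsCoprime 𝔭 𝔫) (hone : coeffC t k f ⊤ = 1) (n : ℕ) :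
    normCoeff t k f 𝔭 * normCoeff t k f (𝔭 ^ (n + 1)) =
      normCoeff t k f (𝔭 ^ (n + 2)) + normCoeff t k f (𝔭 ^ n) := by
  have hN : (((Ideal.absNorm 𝔭 : ℝ) ^ (((maxWeight k : ℝ) - 1) / 2) : ℝ) : ℂ) ≠ 0 :=
    Complex.ofReal_ne_zero.mpr (Real.rpow_pos_of_pos (absNorm_cast_pos h𝔭0) _).ne'
  have hc𝔭 := hf.eigenvalue_mul_normCoeff_eq_of_not_dvd ht h𝔭 h𝔭0 h𝔭𝔫
    (𝔪 := ⊤) fun h => h𝔭.ne_top (top_le_iff.mp (Ideal.dvd_iff_le.mp h))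
  rw [normCoeff_top hone, mul_one, Ideal.mul_top] at hc𝔭
  have hrec := hf.eigenvalue_mul_normCoeff_mul_eq ht h𝔭 h𝔭0 h𝔭𝔫 (pow_ne_zero n h𝔭0)
  rw [hc𝔭, mul_assoc, ← pow_succ', ← pow_succ'] at hrec
  exact mul_left_cancel₀ hN hrec

lemma IsHeckeEigenform.normCoeff_pow_eq (hf : IsHeckeEigenform t k 𝔫 𝔭 f c)
    (ht : IsRepresentatives t) (h𝔭 : 𝔭.IsMaximal) (h𝔭0 : 𝔭 ≠ ⊥)
    (h𝔭𝔫 : IsCoprime 𝔭 𝔫) (hone : coeffC t k f ⊤ = 1) (n : ℕ) :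
    normCoeff t k f (𝔭 ^ n) = (Polynomial.Chebyshev.S ℂ n).eval (normCoeff t k f 𝔭) := by
  refine eq_eval_chebyshev_S_of_recursion (c := fun n => normCoeff t k f (𝔭 ^ n)) ?_ ?_
    (fun n => ?_) n
  · simpa using normCoeff_top hone
  · rw [pow_one]
  · exact eq_sub_of_add_eq (hf.normCoeff_mul_normCoeff_pow ht h𝔭 h𝔭0 h𝔭𝔫 hone n).symm

end HeckeRelations

section Sine

lemma two_mul_le_sin_of_le_half {y : ℝ} (h0 : 0 ≤ y) (h1 : y ≤ 1 / 2) :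
    2 * y ≤ Real.sin (Real.pi * y) := by
  have hsin := Real.mul_le_sin (x := Real.pi * y) (by positivity) (by nlinarith [Real.pi_pos])
  rwa [show 2 / Real.pi * (Real.pi * y) = 2 * y by field_simp] at hsin

lemma two_mul_distInt_le_abs_sin (x : ℝ) : 2 * distInt x ≤ |Real.sin (Real.pi * x)| := by
  have hround : |Real.sin (Real.pi * x)| = |Real.sin (Real.pi * (x - round x))| := by
    rw [mul_sub, mul_comm Real.pi (round x : ℝ), Real.sin_sub_int_mul_pi, abs_mul, abs_zpow,
      abs_neg, abs_one, one_zpow, one_mul]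
  have habs : |Real.sin (Real.pi * (x - round x))| = |Real.sin (Real.pi * distInt x)| := by
    rcases abs_choice (x - round x) with h | h <;>
      simp only [distInt, h, mul_neg, Real.sin_neg, abs_neg]
  rw [hround, habs]
  exact (two_mul_le_sin_of_le_half (abs_nonneg _) (abs_sub_round x)).trans (le_abs_self _)

end Sine

end HilbertForm

end

theorem mainTheorem5_general {F : Type*} [Field F] [NumberField F] [IsTotallyReal F]
    {t : HilbertForm.NarrowClassGroup F → (FractionalIdeal (𝓞 F)⁰ F)ˣ}
    (ht : HilbertForm.IsRepresentatives t) {k : (F →+* ℝ) → ℕ} {𝔫 𝔭 : Ideal (𝓞 F)}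
    (h𝔭 : 𝔭.IsPrime) (h𝔭0 : 𝔭 ≠ ⊥) (h𝔭𝔫 : ¬ 𝔭 ∣ 𝔫)
    {f : HilbertForm.Family F} {c : ℂ} (hf : HilbertForm.IsHeckeEigenform t k 𝔫 𝔭 f c)
    (hone : HilbertForm.coeffC t k f ⊤ = 1) {θ : ℝ}
    (hθ : HilbertForm.normCoeff t k f 𝔭 = ((2 * Real.cos θ : ℝ) : ℂ)) {η : ℝ}
    (hη : HilbertForm.IsBadApproxConst η (θ / Real.pi)) (n : ℕ) :
    2 * η / (n + 1) < ‖HilbertForm.normCoeff t k f (𝔭 ^ n)‖ := by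
  have hmax := h𝔭.isMaximal h𝔭0
  have hcop : IsCoprime 𝔭 𝔫 := Ideal.isCoprime_iff_codisjoint.mpr
    (hmax.out.not_le_iff_codisjoint.mp (Ideal.dvd_iff_le.not.mp h𝔭𝔫))
  have hangle : Real.pi * ((n + 1 : ℕ) * (θ / Real.pi)) = (n + 1) * θ := by
    push_cast
    field_simp
  calc 2 * η / (n + 1) = 2 * (η / (n + 1 : ℕ)) := by rw [mul_div_assoc, Nat.cast_succ]
    _ < 2 * HilbertForm.distInt ((n + 1 : ℕ) * (θ / Real.pi)) := by
      gcongr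
      exact hη.2 (n + 1) n.succ_pos
    _ ≤ |Real.sin ((n + 1) * θ)| := hangle ▸ HilbertForm.two_mul_distInt_le_abs_sin _
    _ ≤ ‖HilbertForm.normCoeff t k f (𝔭 ^ n)‖ := by
      rw [hf.normCoeff_pow_eq ht hmax h𝔭0 hcop hone, hθ]
      exact HilbertForm.abs_sin_le_norm_eval_chebyshev_S θ n

theorem mainTheorem5 {F : Type*} [Field F] [NumberField F] [NumberField.IsTotallyReal F]
    (t : HilbertForm.NarrowClassGroup F → (FractionalIdeal (𝓞 F)⁰ F)ˣ)
    (ht : HilbertForm.IsRepresentatives t)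
    (k : (F →+* ℝ) → ℕ) (hk_even : ∀ σ, Even (k σ)) (hk : ∀ σ, 2 ≤ k σ)
    (𝔫 : Ideal (𝓞 F)) (h𝔫 : 𝔫 ≠ ⊥)
    (f : HilbertForm.Family F) (hf : HilbertForm.IsPrimitive t k 𝔫 f)
    (𝔭 : Ideal (𝓞 F)) (h𝔭 : 𝔭.IsPrime) (h𝔭0 : 𝔭 ≠ ⊥) (h𝔭𝔫 : ¬ 𝔭 ∣ 𝔫)
    (θ : ℝ) (hθ : HilbertForm.IsHeckeAngle t k f 𝔭 θ)
    (hbad : HilbertForm.BadlyApproximable (θ / Real.pi)) :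
    (∃ η : ℝ, 0 < η ∧ ∀ n : ℕ, 1 ≤ n →
      η / ((n : ℝ) + 1) < ‖HilbertForm.normCoeff t k f (𝔭 ^ n)‖) ∧
    (∀ η : ℝ, HilbertForm.IsBadApproxConst η (θ / Real.pi) → ∀ n : ℕ, 1 ≤ n →
      η / ((n : ℝ) + 1) < ‖HilbertForm.normCoeff t k f (𝔭 ^ n)‖) := by
  obtain ⟨c, hc⟩ := hf.exists_isHeckeEigenform h𝔭0
  have hbound (η : ℝ) (hη : HilbertForm.IsBadApproxConst η (θ / Real.pi)) (n : ℕ) (_ : 1 ≤ n) :=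
    (div_le_div_of_nonneg_right (le_mul_of_one_le_left hη.1.le one_le_two)
      n.cast_add_one_pos.le).trans_lt
      (mainTheorem5_general ht h𝔭 h𝔭0 h𝔭𝔫 hc hf.normalized hθ.2 hη n)
  exact ⟨hbad.imp fun η hη => ⟨hη.1, hbound η hη⟩, hbound⟩
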